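/- \textbf{Conventions.} All alphabets are finite, all Hilbert spaces are finite dimensional, and $\log$ is to base $2$. A subnormalised density matrix is a positive semidefinite matrix of trace at most $1$. Write $\|A\|_1=\mathrm{Tr}\sqrt{A^\dagger A}$ and $\|A\|_2=\sqrt{\mathrm{Tr}(A^\dagger A)}$. For positive semidefinite $\alpha,\beta$ on the same space put $$D_2(\alpha\|\beta)=2\log\|\beta^{-1/4}\alpha\beta^{-1/4}\|_2\ \text{ if } \mathrm{supp}(\alpha)\subseteq\mathrm{supp}(\beta),\qquad D_2(\alpha\|\beta)=+\infty\ \text{ otherwise},$$ where negative powers are taken on the support (Moore--Penrose pseudoinverse). For $0<\epsilon<1$ put $$D_2^\epsilon(\alpha\|\beta)=\min_{\alpha'}D_2(\alpha'\|\beta),$$ the minimum being over all subnormalised density matrices $\alpha'$ with $\|\alpha'-\alpha\|_1\le\epsilon\,\mathrm{Tr}\,\alpha$. \textbf{Proposition (smooth multipartite classical-quantum soft covering in expectation).} Let $k\ge 1$, let $X_1,\dots,X_k$ be finite alphabets, let $M$ be a finite-dimensional Hilbert space, and let $0<\epsilon<1$. Let $p$ be a probability distribution on $X_{[k]}=X_1\times\cdots\times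 X_k$ and let $q^{X_i}$ be a probability distribution on $X_i$ for each $i$, such that the support of the marginal $p^{X_i}$ is contained in the support of $q^{X_i}$. For each $x=(x_1,\dots,x_k)\in X_{[k]}$ let $\rho^M_x$ be a subnormalised density matrix on $M$. Define the control state $$\rho=\rho^{X_{[k]}M}=\sum_{x\in X_{[k]}}p(x)\,|x\rangle\langle x|\otimes\rho^M_x$$ and assume $\mathrm{Tr}\,\rho>0$. For $S\subseteq[k]$ let $\rho^{X_SM}$ and $\rho^M$ be its reduced states on $X_SM$ and on $M$, and let $q^{X_S}=\prod_{s\in S}q^{X_s}$, regarded as a diagonal density matrix. Let $A_1,\dots,A_k$ be positive integers. For tuples $x_i^{(A_i)}=(x_i(1),\dots,x_i(A_i))\in X_i^{A_i}$, $i\in[k]$, define the sample average covering state $$\sigma^M_{x_1^{(A_1)},\dots,x_k^{(A_k)}}=\frac1{A_1\cdots A_k}\sum_{a_1=1}^{A_1}\cdots\sum_{a_k=1}^{A_k}\frac{p(x_1(a_1),\dots,x_k(a_k))}{q^{X_1}(x_1(a_1))\cdots q^{X_k}(x_k(a_k))}\,\rho^M_{x_1(a_1),\dots,x_k(a_k)}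 .$$ Suppose that for every non-empty $S\subseteq[k]$ $$\sum_{s\in S}\log A_s>D_2^\epsilon\bigl(\rho^{X_SM}\,\big\|\,q^{X_S}\otimes\rho^M\bigr)+\log\epsilon^{-2}+\log(\mathrm{Tr}\,\rho)^{-1}.$$ (The last term vanishes when $\mathrm{Tr}\,\rho=1$.) Then $$\mathbb{E}\Bigl[\bigl\|\sigma^M_{x_1^{(A_1)},\dots,x_k^{(A_k)}}-\rho^M\bigr\|_1\Bigr]<2(3^k-1)\,\epsilon\,\mathrm{Tr}\,\rho,$$ where all the entries $x_i(a)$, $i\in[k]$, $a\in[A_i]$, are independent and $x_i(a)$ has distribution $q^{X_i}$. -/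

import Mathlib

open scoped Kronecker ComplexOrder

noncomputable section

namespace SoftCovering

/-! ## Matrices, norms and Rényi-2 divergences -/

section Matrices

variable {n : Type*} [Fintype n] [DecidableEq n]

/-- A subnormalised density matrix: positive semidefinite with trace at most one. -/
def IsSubnormalised (α : Matrix n n ℂ) : Prop :=
  α.PosSemidef ∧ α.trace.re ≤ 1

/-- The Schatten 1-norm `Tr √(A†A)`. -/
def schattenOne (A : Matrix n n ℂ) : ℝ :=
  (cfc Real.sqrt (A.conjTranspose * A)).trace.re

/-- The Schatten 2-norm `√(Tr (A†A))`. -/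
def schattenTwo (A : Matrix n n ℂ) : ℝ :=
  Real.sqrt (A.conjTranspose * A).trace.re

/-- The support of a Hermitian matrix (the span of its eigenvectors with nonzero eigenvalue),
that is, its range. -/
def supp (A : Matrix n n ℂ) : Submodule ℂ (n → ℂ) :=
  LinearMap.range (Matrix.toLin' A)

/-- `β ^ (-1/4)` for positive semidefinite `β`, in the sense of the Moore-Penrose pseudoinverse:
the inverse fourth root on the support of `β` and zero on its orthogonal complement. -/
def invFourthRoot (β : Matrix n n ℂ) : Matrix n n ℂ :=
  cfc (fun t : ℝ => if t = 0 then 0 else t ^ (-(1 / 4) : ℝ)) β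

/-- The (non-smooth) Rényi-2 divergence
`D₂(α‖β) = 2 log₂ ‖β^(-1/4) α β^(-1/4)‖₂` if `supp α ≤ supp β`, and `+∞` otherwise;
here `log₂ 0 = -∞`. -/
def renyiTwo (α β : Matrix n n ℂ) : EReal :=
  open scoped Classical in
  if supp α ≤ supp β then
    if schattenTwo (invFourthRoot β * α * invFourthRoot β) = 0 then ⊥
    else ((2 * Real.logb 2 (schattenTwo (invFourthRoot β * α * invFourthRoot β)) : ℝ) : EReal)
  else ⊤

/-- The `ε`-smooth Rényi-2 divergence: the infimum of `D₂(α'‖β)` over all subnormalised density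
matrices `α'` with `‖α' - α‖₁ ≤ ε Tr α`. -/
def smoothRenyiTwo (ε : ℝ) (α β : Matrix n n ℂ) : EReal :=
  ⨅ α' ∈ {α' : Matrix n n ℂ | IsSubnormalised α' ∧ schattenOne (α' - α) ≤ ε * α.trace.re},
    renyiTwo α' β

end Matrices

/-! ## Classical-quantum states on `X₁ ⋯ X_k M` -/

section States

variable {k : ℕ} {X : Fin k → Type*} [∀ i, Fintype (X i)] [∀ i, DecidableEq (X i)]
variable {m : Type*} [Fintype m] [DecidableEq m]

/-- The marginal on the `i`-th alphabet of a function `p` on the product alphabet. -/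
def marginal (p : (∀ i, X i) → ℝ) (i : Fin k) (a : X i) : ℝ :=
  ∑ x : (∀ i, X i) with x i = a, p x

/-- The control state `∑ₓ p(x) |x⟩⟨x| ⊗ ρₓ`. -/
def controlState (p : (∀ i, X i) → ℝ) (ρ : (∀ i, X i) → Matrix m m ℂ) :
    Matrix ((∀ i, X i) × m) ((∀ i, X i) × m) ℂ :=
  ∑ x, (p x : ℂ) • (Matrix.single x x (1 : ℂ) ⊗ₖ ρ x)

/-- The reduced state on `X_S M`: the partial trace over the registers `X_i`, `i ∉ S`. -/
def reduceTo (S : Finset (Fin k)) (R : Matrix ((∀ i, X i) × m) ((∀ i, X i) × m) ℂ) :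
    Matrix ((∀ i : {i // i ∈ S}, X i) × m) ((∀ i : {i // i ∈ S}, X i) × m) ℂ :=
  Matrix.of fun u v => ∑ z : (∀ i : {i // i ∉ S}, X i),
    R ((Equiv.piEquivPiSubtypeProd (· ∈ S) X).symm (u.1, z), u.2)
      ((Equiv.piEquivPiSubtypeProd (· ∈ S) X).symm (v.1, z), v.2)

/-- The reduced state on `M`: the partial trace over all registers `X_i`. -/
def reduceToM (R : Matrix ((∀ i, X i) × m) ((∀ i, X i) × m) ℂ) : Matrix m m ℂ :=
  Matrix.of fun a b => ∑ x : (∀ i, X i), R (x, a) (x, b)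

/-- The product distribution `q^{X_S} = ×_{s ∈ S} q_s` as a diagonal density matrix. -/
def productState (q : ∀ i, X i → ℝ) (S : Finset (Fin k)) :
    Matrix (∀ i : {i // i ∈ S}, X i) (∀ i : {i // i ∈ S}, X i) ℂ :=
  Matrix.diagonal fun y => ((∏ s : {i // i ∈ S}, q s (y s) : ℝ) : ℂ)

/-- The sample average covering state of the tuples
`x i = (x_i(1), …, x_i(A_i))`, with the change of measure from `∏ q_i` to `p`. -/
def sampleAverage (p : (∀ i, X i) → ℝ) (q : ∀ i, X i → ℝ) (ρ : (∀ i, X i) → Matrix m m ℂ)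
    (A : Fin k → ℕ) (x : ∀ i, Fin (A i) → X i) : Matrix m m ℂ :=
  ((∏ i, (A i : ℂ))⁻¹) • ∑ a : (∀ i, Fin (A i)),
    ((p (fun i => x i (a i)) / ∏ i, q i (x i (a i)) : ℝ) : ℂ) • ρ (fun i => x i (a i))

/-- The expectation of `f` over independent tuples `x i`, each consisting of `A i` independent
samples from `q i`. -/
def expectIID (q : ∀ i, X i → ℝ) (A : Fin k → ℕ) (f : (∀ i, Fin (A i) → X i) → ℝ) : ℝ :=
  ∑ x : (∀ i, Fin (A i) → X i), (∏ i, ∏ j, q i (x i j)) * f x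

end States

end SoftCovering

end

/-!
Write `F(y) = p(y) / q(y) • ρ_y`, so that the covering state is the sample mean of `F` over the grid
of samples, and split `F` by its Hoeffding (Efron–Stein) decomposition under the product
distribution `q`: the component of `S` depends on the coordinates in `S` only and is centred in each
of them, and that of `∅` is `ρ^M`. In the sample mean of the component of `S`, two different
`S`-tuples of samples are uncorrelated, so averaging divides the second moment by `∏ s ∈ S, A_s`.

The component of `S` is the alternating sum of the conditional expectations of `F` on the subsets
of `S`, the top one being the normalised blocks of `ρ^{X_S M}`. Replacing that state by a smoothing
`α'` costs `ε Tr ρ` in trace norm. For `α'`, Hölder's inequality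
`‖B A B‖₁ ≤ √(Tr ρ^M) ‖A‖₂` with `B = (ρ^M)^(1/4)` passes to the 2-norm, whose second moment is
`2 ^ D₂(α' ‖ q^{X_S} ⊗ ρ^M)`; by the rate condition this contributes less than another `ε Tr ρ`.
Each of the `2 ^ |S|` terms of the alternating sum obeys this bound, and
`∑_{S ≠ ∅} 2 ^ |S| · 2 = 2 (3 ^ k - 1)`.
-/

noncomputable section

namespace SoftCovering

section Product

open Finset

variable {ι : Type*} [Fintype ι] {X : ι → Type*}

/-- The weight `∏ i, q i (y i)` of a point under the product of the weights `q i`. -/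
def weight (q : ∀ i, X i → ℝ) (y : ∀ i, X i) : ℝ := ∏ i, q i (y i)

lemma weight_nonneg {q : ∀ i, X i → ℝ} (hq0 : ∀ i a, 0 ≤ q i a) (y : ∀ i, X i) :
    0 ≤ weight q y :=
  prod_nonneg fun i _ => hq0 i _

variable [DecidableEq ι] [∀ i, Fintype (X i)] {q : ∀ i, X i → ℝ}

lemma sum_weight (hq : ∀ i, ∑ a, q i a = 1) : ∑ y, weight q y = 1 := by
  simp [weight, ← Fintype.prod_sum, hq]

variable {E F : Type*} [AddCommGroup E] [Module ℝ E] [AddCommGroup F] [Module ℝ F]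

/-- The expectation of a vector-valued function of independent coordinates `y i` with
distributions `q i`, as a linear map in the function. -/
def expectation (q : ∀ i, X i → ℝ) : ((∀ i, X i) → E) →ₗ[ℝ] E :=
  ∑ y, weight q y • LinearMap.proj y

lemma expectation_apply (f : (∀ i, X i) → E) : expectation q f = ∑ y, weight q y • f y := by
  simp [expectation]

lemma expectation_const (hq : ∀ i, ∑ a, q i a = 1) (v : E) : expectation q (fun _ => v) = v := by
  rw [expectation_apply, ← sum_smul, sum_weight hq, one_smul]

lemma expectation_mono (hq0 : ∀ i a, 0 ≤ q i a) {f g : (∀ i, X i) → ℝ} (hfg : ∀ y, f y ≤ g y) :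
    expectation q f ≤ expectation q g := by
  simp only [expectation_apply]
  exact sum_le_sum fun y _ => mul_le_mul_of_nonneg_left (hfg y) (weight_nonneg hq0 y)

lemma map_expectation (L : E →ₗ[ℝ] F) (f : (∀ i, X i) → E) :
    L (expectation q f) = expectation q fun y => L (f y) := by
  simp [expectation_apply]

lemma map_expectation_le_of_convexOn (hq0 : ∀ i a, 0 ≤ q i a) (hq : ∀ i, ∑ a, q i a = 1)
    {φ : E → ℝ} (hφ : ConvexOn ℝ Set.univ φ) (f : (∀ i, X i) → E) :
    φ (expectation q f) ≤ expectation q fun y => φ (f y) := by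
  simp only [expectation_apply]
  exact hφ.map_sum_le (fun y _ => weight_nonneg hq0 y) (sum_weight hq) fun _ _ => Set.mem_univ _

lemma expectation_comp_injective {κ : Type*} [Fintype κ] [DecidableEq κ]
    (hq : ∀ i, ∑ a, q i a = 1) {e : κ → ι} (he : e.Injective) (φ : (∀ j, X (e j)) → E) :
    expectation q (fun y => φ fun j => y (e j)) = expectation (fun j => q (e j)) φ := by
  classical
  let π : (∀ i, X i) → ∀ j, X (e j) := fun y j => y (e j)
  have hfiber (u : ∀ j, X (e j)) :
      ∑ y with π y = u, weight q y = weight (fun j => q (e j)) u := by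
    let s : ∀ i, Finset (X i) := fun i => univ.filter fun a => ∀ j, ∀ h : e j = i, h ▸ u j = a
    have hs : univ.filter (fun y => π y = u) = Fintype.piFinset s := by
      ext y
      simp only [mem_filter_univ, Fintype.mem_piFinset, s, π, funext_iff]
      exact ⟨by rintro h _ j rfl; exact (h j).symm, fun h j => (h (e j) j rfl).symm⟩
    simp only [hs, weight]
    rw [← prod_univ_sum]
    refine (Fintype.prod_of_injective e he _ _ (fun i hi => ?_) fun j => ?_).symm
    · have : s i = univ := filter_true_of_mem fun a _ j h => (hi ⟨j, h⟩).elim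
      rw [this, hq]
    · have : s (e j) = {u j} := by
        ext a
        simp only [s, mem_filter_univ, mem_singleton]
        refine ⟨fun h => (h j rfl).symm, ?_⟩
        rintro rfl j' h
        obtain rfl := he h
        rfl
      rw [this, sum_singleton]
  rw [expectation_apply, expectation_apply, ← sum_fiberwise univ π]
  refine sum_congr rfl fun u _ => ?_
  rw [← hfiber, sum_smul]
  exact sum_congr rfl fun y hy => by rw [← (mem_filter.1 hy).2]

/-- The average of `f` over the coordinates outside `T`, with the coordinates in `T` held fixed. -/
def average (q : ∀ i, X i → ℝ) (T : Finset ι) : ((∀ i, X i) → E) →ₗ[ℝ] (∀ i, X i) → E :=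
  LinearMap.pi fun x => expectation q ∘ₗ LinearMap.funLeft ℝ E fun z => T.piecewise x z

lemma average_apply (T : Finset ι) (f : (∀ i, X i) → E) (x : ∀ i, X i) :
    average q T f x = expectation q fun z => f (T.piecewise x z) :=
  rfl

lemma average_univ (hq : ∀ i, ∑ a, q i a = 1) (f : (∀ i, X i) → E) : average q univ f = f := by
  ext x
  simp [average_apply, expectation_const hq]

lemma average_empty (f : (∀ i, X i) → E) (x : ∀ i, X i) :
    average q ∅ f x = expectation q f := by
  simp [average_apply]

lemma map_average (L : E →ₗ[ℝ] F) (T : Finset ι) (f : (∀ i, X i) → E) (x : ∀ i, X i) :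
    L (average q T f x) = average q T (fun y => L (f y)) x :=
  map_expectation L _

/- Exchanging the coordinates outside `T` of two independent points preserves their joint weight,
so `T.piecewise y z` is distributed as `y`. -/
lemma expectation_average (hq : ∀ i, ∑ a, q i a = 1) (T : Finset ι) (f : (∀ i, X i) → E) :
    expectation q (average q T f) = expectation q f := by
  have hswap : Function.Involutive fun p : (∀ i, X i) × (∀ i, X i) =>
      (T.piecewise p.1 p.2, T.piecewise p.2 p.1) := by
    rintro ⟨y, z⟩
    ext i <;> by_cases hi : i ∈ T <;> simp [hi]
  have hweight (p : (∀ i, X i) × (∀ i, X i)) :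
      weight q (T.piecewise p.1 p.2) * weight q (T.piecewise p.2 p.1)
        = weight q p.1 * weight q p.2 := by
    simp only [weight, ← prod_mul_distrib]
    refine prod_congr rfl fun i _ => ?_
    by_cases hi : i ∈ T <;> simp [hi, mul_comm]
  calc expectation q (average q T f)
      = ∑ p : (∀ i, X i) × (∀ i, X i), (weight q p.1 * weight q p.2) • f (T.piecewise p.1 p.2) := by
        simp [average_apply, expectation_apply, Fintype.sum_prod_type, smul_sum, mul_smul]
    _ = ∑ p : (∀ i, X i) × (∀ i, X i), (weight q p.1 * weight q p.2) • f p.1 := by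
        rw [← (Equiv.ofBijective _ hswap.bijective).sum_comp]
        refine sum_congr rfl fun p _ => ?_
        simp only [Equiv.ofBijective_apply, hweight]
        congr 2
        exact congrArg Prod.fst (hswap p)
    _ = expectation q f := by
        simp only [Fintype.sum_prod_type, ← sum_smul, ← mul_sum, sum_weight hq, mul_one,
          expectation_apply]

lemma average_average (hq : ∀ i, ∑ a, q i a = 1) (T S : Finset ι) (f : (∀ i, X i) → E) :
    average q T (average q S f) = average q (T ∩ S) f := by
  ext x
  have hpiecewise (y z : ∀ i, X i) :
      S.piecewise (T.piecewise x y) z = (T ∩ S).piecewise x (S.piecewise y z) := by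
    ext i
    by_cases hS : i ∈ S <;> by_cases hT : i ∈ T <;> simp [hS, hT]
  rw [average_apply, average_apply,
    ← expectation_average hq S fun z => f ((T ∩ S).piecewise x z)]
  simp only [average_apply, hpiecewise]
  rfl

lemma expectation_map_average_le (hq0 : ∀ i a, 0 ≤ q i a) (hq : ∀ i, ∑ a, q i a = 1)
    {φ : E → ℝ} (hφ : ConvexOn ℝ Set.univ φ) (T : Finset ι) (f : (∀ i, X i) → E) :
    (expectation q fun y => φ (average q T f y)) ≤ expectation q fun y => φ (f y) := by
  rw [← expectation_average hq T fun y => φ (f y)]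
  exact expectation_mono hq0 fun y => map_expectation_le_of_convexOn hq0 hq hφ _

lemma expectation_bilin_average (hq : ∀ i, ∑ a, q i a = 1) {G : Type*} [AddCommGroup G]
    [Module ℝ G] (B : E →ₗ[ℝ] F →ₗ[ℝ] G) (T : Finset ι) (f : (∀ i, X i) → E)
    {g : (∀ i, X i) → F} (hg : ∀ x z, g (T.piecewise x z) = g x) :
    (expectation q fun y => B (f y) (g y)) = expectation q fun y => B (average q T f y) (g y) := by
  rw [← expectation_average hq T fun y => B (f y) (g y)]
  congr 1 with x
  simpa [average_apply, hg] using (map_expectation (q := q) (B.flip (g x)) _).symm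

lemma average_comp_injective {κ : Type*} [Fintype κ] [DecidableEq κ]
    (hq : ∀ i, ∑ a, q i a = 1) {e : κ → ι} (he : e.Injective) (T : Finset ι)
    (φ : (∀ j, X (e j)) → E) (x : ∀ i, X i) :
    average q T (fun y => φ fun j => y (e j)) x
      = average (fun j => q (e j)) (T.preimage e he.injOn) φ fun j => x (e j) := by
  rw [average_apply, average_apply, ← expectation_comp_injective hq he]
  congr! 4 with y j
  by_cases hj : e j ∈ T <;> simp [hj]

/-- The component of `f` on the coordinates in `S` in its Hoeffding (ANOVA) decomposition. -/
def hoeffding (q : ∀ i, X i → ℝ) (S : Finset ι) : ((∀ i, X i) → E) →ₗ[ℝ] (∀ i, X i) → E :=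
  ∑ T ∈ S.powerset, (-1 : ℝ) ^ #(S \ T) • average q T

lemma hoeffding_apply (S : Finset ι) (f : (∀ i, X i) → E) (x : ∀ i, X i) :
    hoeffding q S f x = ∑ T ∈ S.powerset, (-1 : ℝ) ^ #(S \ T) • average q T f x := by
  simp [hoeffding]

lemma map_hoeffding (L : E →ₗ[ℝ] F) (S : Finset ι) (f : (∀ i, X i) → E) (x : ∀ i, X i) :
    L (hoeffding q S f x) = hoeffding q S (fun y => L (f y)) x := by
  simp [hoeffding_apply, map_average]

lemma hoeffding_empty (f : (∀ i, X i) → E) (x : ∀ i, X i) :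
    hoeffding q ∅ f x = expectation q f := by
  simp [hoeffding_apply, average_empty]

lemma hoeffding_average (hq : ∀ i, ∑ a, q i a = 1) (S : Finset ι) (f : (∀ i, X i) → E) :
    hoeffding q S (average q S f) = hoeffding q S f := by
  ext x
  simp only [hoeffding_apply, average_average hq]
  exact sum_congr rfl fun T hT => by rw [inter_eq_left.2 (mem_powerset.1 hT)]

lemma average_compl_singleton_hoeffding (hq : ∀ i, ∑ a, q i a = 1) {S : Finset ι} {i : ι}
    (hi : i ∈ S) (f : (∀ i, X i) → E) : average q {i}ᶜ (hoeffding q S f) = 0 := by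
  obtain ⟨S, hiS, rfl⟩ : ∃ S', i ∉ S' ∧ insert i S' = S :=
    ⟨S.erase i, notMem_erase i S, insert_erase hi⟩
  have hpair : ∀ T ∈ S.powerset,
      (-1 : ℝ) ^ #(insert i S \ T) • average q ({i}ᶜ ∩ T) f
        + (-1 : ℝ) ^ #(insert i S \ insert i T) • average q ({i}ᶜ ∩ insert i T) f = 0 := by
    intro T hT
    have hiT : i ∉ T := fun h => hiS (mem_powerset.1 hT h)
    have hinter : {i}ᶜ ∩ insert i T = {i}ᶜ ∩ T := by ext j; by_cases j = i <;> simp_all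
    rw [hinter, insert_sdiff_of_notMem _ hiT, insert_sdiff_insert,
      sdiff_insert_of_notMem hiS, card_insert_of_notMem (by simp [hiS]), pow_succ]
    module
  simp only [hoeffding, LinearMap.sum_apply, LinearMap.smul_apply, map_sum, map_smul,
    average_average hq]
  rw [sum_powerset_insert hiS, ← sum_add_distrib]
  exact sum_eq_zero hpair

lemma sum_superset_neg_one_pow (T : Finset ι) :
    ∑ S with T ⊆ S, (-1 : ℝ) ^ #(S \ T) = if T = univ then 1 else 0 := by
  have hIcc : univ.filter (T ⊆ ·) = Tᶜ.powerset.image (T ∪ ·) := by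
    rw [compl_eq_univ_sdiff, ← Icc_eq_image_powerset (subset_univ T)]
    ext
    simp
  have hdisj {U : Finset ι} (hU : U ∈ Tᶜ.powerset) : Disjoint T U :=
    disjoint_compl_right.mono_right (mem_powerset.1 hU)
  rw [hIcc, sum_image fun U hU V hV h => ?_]
  · calc ∑ U ∈ Tᶜ.powerset, (-1 : ℝ) ^ #((T ∪ U) \ T)
        = ∑ U ∈ Tᶜ.powerset, (-1 : ℝ) ^ #U * 1 ^ (#Tᶜ - #U) :=
          sum_congr rfl fun U hU => by
            rw [union_sdiff_cancel_left (hdisj hU), one_pow, mul_one]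
      _ = if T = univ then 1 else 0 := by
          rw [sum_pow_mul_eq_add_pow, neg_add_cancel, zero_pow_eq]
          simp
  · simpa [union_sdiff_cancel_left, hdisj hU, hdisj hV] using congrArg (· \ T) h

lemma sum_hoeffding (hq : ∀ i, ∑ a, q i a = 1) (f : (∀ i, X i) → E) (x : ∀ i, X i) :
    ∑ S, hoeffding q S f x = f x := by
  simp only [hoeffding_apply]
  rw [sum_comm' (t' := univ) (s' := fun T => univ.filter (T ⊆ ·)) (by simp)]
  simp [← sum_smul, sum_superset_neg_one_pow, average_univ hq]

lemma expectation_map_hoeffding_le (hq0 : ∀ i a, 0 ≤ q i a) (hq : ∀ i, ∑ a, q i a = 1)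
    {φ : E → ℝ} (hφ : ConvexOn ℝ Set.univ φ) (heven : φ.Even) (S : Finset ι)
    (f : (∀ i, X i) → E) :
    (expectation q fun y => φ (hoeffding q S f y))
      ≤ expectation q fun y => φ ((2 : ℝ) ^ #S • f y) := by
  have hsign (n : ℕ) (v : E) : φ ((-1 : ℝ) ^ n • v) = φ v := by
    obtain h | h := neg_one_pow_eq_or ℝ n <;> simp [h, heven v]
  have hpoint (y : ∀ i, X i) : φ (hoeffding q S f y)
      ≤ ∑ T ∈ S.powerset, ((2 : ℝ) ^ #S)⁻¹ * φ (average q T ((2 : ℝ) ^ #S • f) y) := by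
    have hmean : hoeffding q S f y = ∑ T ∈ S.powerset,
        ((2 : ℝ) ^ #S)⁻¹ • (-1 : ℝ) ^ #(S \ T) • average q T ((2 : ℝ) ^ #S • f) y := by
      rw [hoeffding_apply]
      refine sum_congr rfl fun _ _ => ?_
      rw [map_smul, Pi.smul_apply, smul_comm _ ((2 : ℝ) ^ #S), inv_smul_smul₀ (by positivity)]
    rw [hmean]
    refine (hφ.map_sum_le (fun _ _ => by positivity) ?_ fun _ _ => Set.mem_univ _).trans_eq ?_
    · simp
    · simp only [hsign, smul_eq_mul]
  calc (expectation q fun y => φ (hoeffding q S f y))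
      ≤ expectation q (∑ T ∈ S.powerset, ((2 : ℝ) ^ #S)⁻¹ •
          fun y => φ (average q T ((2 : ℝ) ^ #S • f) y)) :=
        expectation_mono hq0 fun y => by simpa using hpoint y
    _ ≤ ∑ _T ∈ S.powerset, ((2 : ℝ) ^ #S)⁻¹ • expectation q fun y => φ ((2 : ℝ) ^ #S • f y) := by
        rw [map_sum]
        refine sum_le_sum fun T _ => ?_
        rw [LinearMap.map_smul]
        exact smul_le_smul_of_nonneg_left (expectation_map_average_le hq0 hq hφ T _) (by positivity)
    _ = expectation q fun y => φ ((2 : ℝ) ^ #S • f y) := by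
        simp

end Product

section Sampling

open Finset

lemma prod_card_ne_zero {ι : Type*} {J : ι → Type*} [∀ i, Fintype (J i)] [∀ i, Nonempty (J i)]
    (S : Finset ι) : ∏ i ∈ S, (Fintype.card (J i) : ℝ) ≠ 0 :=
  prod_ne_zero_iff.2 fun _ _ => Nat.cast_ne_zero.2 Fintype.card_ne_zero

variable {ι : Type*} [Fintype ι] [DecidableEq ι] {X : ι → Type*}
variable {J : ι → Type*} [∀ i, Fintype (J i)]
variable {E F : Type*} [AddCommGroup E] [Module ℝ E] [AddCommGroup F] [Module ℝ F]

/-- The average of `h` over all points whose `i`-th coordinate is one of the samples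
`ω ⟨i, j⟩`, `j : J i`, for every `i`, as a linear map in `h`. -/
def sampleMean : ((∀ i, X i) → E) →ₗ[ℝ] (∀ s : Σ i, J i, X s.1) → E :=
  (∏ i, (Fintype.card (J i) : ℝ))⁻¹ •
    ∑ a : ∀ i, J i, LinearMap.funLeft ℝ E fun ω i => ω ⟨i, a i⟩

lemma sampleMean_apply (h : (∀ i, X i) → E) (ω : ∀ s : Σ i, J i, X s.1) :
    sampleMean h ω = (∏ i, (Fintype.card (J i) : ℝ))⁻¹ •
      ∑ a : ∀ i, J i, h fun i => ω ⟨i, a i⟩ := by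
  simp [sampleMean, LinearMap.funLeft]

lemma map_sampleMean (L : E →ₗ[ℝ] F) (h : (∀ i, X i) → E) (ω : ∀ s : Σ i, J i, X s.1) :
    L (sampleMean h ω) = sampleMean (fun y => L (h y)) ω := by
  simp [sampleMean_apply]

section Nonempty

variable [∀ i, Nonempty (J i)]

lemma sampleMean_const (v : E) (ω : ∀ s : Σ i, J i, X s.1) :
    sampleMean (fun _ : ∀ i, X i => v) ω = v := by
  rw [sampleMean_apply, sum_const, card_univ, Fintype.card_pi, ← Nat.cast_smul_eq_nsmul ℝ,
    Nat.cast_prod, inv_smul_smul₀ (prod_card_ne_zero univ)]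

lemma map_sampleMean_le_of_convexOn {φ : E → ℝ} (hφ : ConvexOn ℝ Set.univ φ) (h : (∀ i, X i) → E)
    (ω : ∀ s : Σ i, J i, X s.1) : φ (sampleMean h ω) ≤ sampleMean (fun y => φ (h y)) ω := by
  simp only [sampleMean_apply, smul_sum]
  refine hφ.map_sum_le (fun _ _ => by positivity) ?_ fun _ _ => Set.mem_univ _
  rw [← sampleMean_const (1 : ℝ) ω, sampleMean_apply, smul_sum]
  simp only [smul_eq_mul, mul_one]

end Nonempty

variable [∀ i, Fintype (X i)] {q : ∀ i, X i → ℝ}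

lemma sampleMean_sub_expectation [∀ i, Nonempty (J i)] (hq : ∀ i, ∑ a, q i a = 1)
    (f : (∀ i, X i) → E) (ω : ∀ s : Σ i, J i, X s.1) :
    sampleMean f ω - expectation q f = ∑ S ∈ univ.erase ∅, sampleMean (hoeffding q S f) ω := by
  have hsum : ∑ S, hoeffding q S f = f := by
    ext x
    simpa using sum_hoeffding hq f x
  have hempty : sampleMean (hoeffding q ∅ f) ω = expectation q f := by
    rw [funext (hoeffding_empty (q := q) f), sampleMean_const]
  calc sampleMean f ω - expectation q f
      = ∑ S, sampleMean (hoeffding q S f) ω - sampleMean (hoeffding q ∅ f) ω := by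
        rw [hempty, ← Finset.sum_apply, ← map_sum, hsum]
    _ = ∑ S ∈ univ.erase ∅, sampleMean (hoeffding q S f) ω := by
        rw [← add_sum_erase _ _ (mem_univ ∅), add_sub_cancel_left]

variable [∀ i, DecidableEq (J i)]

lemma expectation_sample (hq : ∀ i, ∑ a, q i a = 1) (a : ∀ i, J i) (φ : (∀ i, X i) → E) :
    expectation (fun s : Σ i, J i => q s.1) (fun ω => φ fun i => ω ⟨i, a i⟩) = expectation q φ :=
  expectation_comp_injective (q := fun s : Σ i, J i => q s.1) (fun s => hq s.1)
    (e := fun i => ⟨i, a i⟩) (fun _ _ h => congrArg Sigma.fst h) φ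

lemma expectation_sampleMean [∀ i, Nonempty (J i)] (hq : ∀ i, ∑ a, q i a = 1)
    (h : (∀ i, X i) → E) :
    expectation (fun s : Σ i, J i => q s.1) (sampleMean h) = expectation q h := by
  have hterm (a : ∀ i, J i) : expectation (fun s : Σ i, J i => q s.1)
      (LinearMap.funLeft ℝ E (fun ω i => ω ⟨i, a i⟩) h) = expectation q h :=
    expectation_sample hq a h
  rw [sampleMean, LinearMap.smul_apply, LinearMap.sum_apply, map_smul, map_sum,
    sum_congr rfl fun a _ => hterm a, sum_const, card_univ, Fintype.card_pi,
    ← Nat.cast_smul_eq_nsmul ℝ, Nat.cast_prod, inv_smul_smul₀ (prod_card_ne_zero univ)]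

lemma expectation_map_sampleMean_le [∀ i, Nonempty (J i)] (hq0 : ∀ i a, 0 ≤ q i a)
    (hq : ∀ i, ∑ a, q i a = 1) {φ : E → ℝ} (hφ : ConvexOn ℝ Set.univ φ) (h : (∀ i, X i) → E) :
    (expectation (fun s : Σ i, J i => q s.1) fun ω => φ (sampleMean h ω))
      ≤ expectation q fun y => φ (h y) := by
  rw [← expectation_sampleMean (J := J) hq]
  exact expectation_mono (fun s => hq0 s.1) fun ω => map_sampleMean_le_of_convexOn hφ h ω

end Sampling

section Variance

open Finset

variable {ι : Type*} [Fintype ι] [DecidableEq ι] {X : ι → Type*} [∀ i, Fintype (X i)]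
  {q : ∀ i, X i → ℝ}
variable {J : ι → Type*} [∀ i, Fintype (J i)] [∀ i, DecidableEq (J i)]
variable {H : Type*} [NormedAddCommGroup H] [InnerProductSpace ℝ H]

lemma expectation_inner_sample_eq_zero (hq : ∀ i, ∑ a, q i a = 1) {h : (∀ i, X i) → H} {i : ι}
    (hi : average q {i}ᶜ h = 0) {a b : ∀ i, J i} (hab : a i ≠ b i) :
    (expectation (fun s : Σ i, J i => q s.1) fun ω =>
      inner ℝ (h fun i => ω ⟨i, a i⟩) (h fun i => ω ⟨i, b i⟩)) = 0 := by
  have hinj : Function.Injective fun j => (⟨j, a j⟩ : Σ i, J i) := fun _ _ h => congrArg Sigma.fst h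
  have hpreimage : ({⟨i, a i⟩}ᶜ : Finset (Σ i, J i)).preimage (fun j => ⟨j, a j⟩) hinj.injOn
      = {i}ᶜ := by
    ext j
    simp only [mem_preimage, mem_compl, mem_singleton]
    exact not_congr ⟨fun h => congrArg Sigma.fst h, by rintro rfl; rfl⟩
  have haverage (ω : ∀ s : Σ i, J i, X s.1) : average (fun s : Σ i, J i => q s.1) {⟨i, a i⟩}ᶜ
      (fun ω => h fun j => ω ⟨j, a j⟩) ω = 0 := by
    rw [average_comp_injective (q := fun s : Σ i, J i => q s.1) (fun s => hq s.1) hinj, hpreimage,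
      hi, Pi.zero_apply]
  have hindep (ω z : ∀ s : Σ i, J i, X s.1) :
      h (fun j => ({⟨i, a i⟩}ᶜ : Finset (Σ i, J i)).piecewise ω z ⟨j, b j⟩)
        = h fun j => ω ⟨j, b j⟩ := by
    congr 1 with j
    refine piecewise_eq_of_mem _ _ _ ?_
    simp only [mem_compl, mem_singleton]
    intro hj
    obtain rfl : j = i := congrArg Sigma.fst hj
    exact hab (eq_of_heq (Sigma.mk.inj hj).2).symm
  refine (expectation_bilin_average (fun s : Σ i, J i => hq s.1) (innerₗ H) {⟨i, a i⟩}ᶜ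
    (fun ω => h fun j => ω ⟨j, a j⟩) (g := fun ω => h fun j => ω ⟨j, b j⟩) hindep).trans ?_
  simp [haverage, expectation_apply]

lemma expectation_inner_sample_le (hq0 : ∀ i a, 0 ≤ q i a) (hq : ∀ i, ∑ a, q i a = 1)
    (h : (∀ i, X i) → H) (a b : ∀ i, J i) :
    (expectation (fun s : Σ i, J i => q s.1) fun ω =>
        inner ℝ (h fun i => ω ⟨i, a i⟩) (h fun i => ω ⟨i, b i⟩))
      ≤ expectation q fun y => ‖h y‖ ^ 2 := by
  have hinner (x y : H) : inner ℝ x y ≤ (1 / 2 : ℝ) * (‖x‖ ^ 2 + ‖y‖ ^ 2) := by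
    linarith [real_inner_le_norm x y, two_mul_le_add_sq ‖x‖ ‖y‖]
  have hsample (a : ∀ i, J i) := expectation_sample hq a fun y => ‖h y‖ ^ 2
  calc (expectation (fun s : Σ i, J i => q s.1) fun ω =>
        inner ℝ (h fun i => ω ⟨i, a i⟩) (h fun i => ω ⟨i, b i⟩))
      ≤ expectation (fun s : Σ i, J i => q s.1) ((1 / 2 : ℝ) •
          ((fun ω => ‖h fun i => ω ⟨i, a i⟩‖ ^ 2) + fun ω => ‖h fun i => ω ⟨i, b i⟩‖ ^ 2)) :=
        expectation_mono (fun s => hq0 s.1) fun ω => hinner _ _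
    _ = expectation q fun y => ‖h y‖ ^ 2 := by
        rw [map_smul, map_add, hsample, hsample, smul_eq_mul]
        ring

lemma card_filter_forall_mem_eq (S : Finset ι) (a : ∀ i, J i) :
    #{b : ∀ i, J i | ∀ i ∈ S, a i = b i} = ∏ i ∈ Sᶜ, Fintype.card (J i) := by
  have hpi : ({b : ∀ i, J i | ∀ i ∈ S, a i = b i} : Finset _)
      = Fintype.piFinset fun i => if i ∈ S then {a i} else univ := by
    ext b
    simp only [mem_filter_univ, Fintype.mem_piFinset]
    refine forall_congr' fun i => ?_
    by_cases hi : i ∈ S <;> simp [hi, eq_comm]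
  rw [hpi, Fintype.card_piFinset, ← prod_mul_prod_compl S,
    prod_eq_one (s := S) fun i hi => by simp [hi], one_mul]
  exact prod_congr rfl fun i hi => by simp [mem_compl.1 hi]

lemma expectation_norm_sq_sampleMean_le [∀ i, Nonempty (J i)] (hq0 : ∀ i a, 0 ≤ q i a)
    (hq : ∀ i, ∑ a, q i a = 1) {h : (∀ i, X i) → H} {S : Finset ι}
    (hS : ∀ i ∈ S, average q {i}ᶜ h = 0) :
    (expectation (fun s : Σ i, J i => q s.1) fun ω => ‖sampleMean h ω‖ ^ 2)
      ≤ (∏ i ∈ S, (Fintype.card (J i) : ℝ))⁻¹ * expectation q fun y => ‖h y‖ ^ 2 := by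
  set c : ℝ := ∏ i, (Fintype.card (J i) : ℝ)
  set V : ℝ := expectation q fun y => ‖h y‖ ^ 2
  let cov (a b : ∀ i, J i) : ℝ := expectation (fun s : Σ i, J i => q s.1) fun ω =>
    inner ℝ (h fun i => ω ⟨i, a i⟩) (h fun i => ω ⟨i, b i⟩)
  have hexpand : (expectation (fun s : Σ i, J i => q s.1) fun ω => ‖sampleMean h ω‖ ^ 2)
      = c⁻¹ ^ 2 * ∑ a, ∑ b, cov a b := by
    simp only [cov, ← map_sum, ← smul_eq_mul (c⁻¹ ^ 2), ← map_smul]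
    congr 1 with ω
    rw [← real_inner_self_eq_norm_sq, sampleMean_apply, real_inner_smul_left,
      real_inner_smul_right, sum_inner, ← mul_assoc, ← sq]
    simp [inner_sum, c]
  have hrow (a : ∀ i, J i) : ∑ b, cov a b ≤ (∏ i ∈ Sᶜ, (Fintype.card (J i) : ℝ)) * V := by
    calc ∑ b, cov a b = ∑ b with ∀ i ∈ S, a i = b i, cov a b := by
          refine (sum_filter_of_ne fun b _ hne i hi => ?_).symm
          by_contra hab
          exact hne (expectation_inner_sample_eq_zero hq (hS i hi) hab)
      _ ≤ #{b : ∀ i, J i | ∀ i ∈ S, a i = b i} • V :=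
          sum_le_card_nsmul _ _ _ fun b _ => expectation_inner_sample_le hq0 hq h a b
      _ = (∏ i ∈ Sᶜ, (Fintype.card (J i) : ℝ)) * V := by
          rw [card_filter_forall_mem_eq, nsmul_eq_mul, Nat.cast_prod]
  have hc : c = (∏ i ∈ S, (Fintype.card (J i) : ℝ)) * ∏ i ∈ Sᶜ, (Fintype.card (J i) : ℝ) :=
    (prod_mul_prod_compl S _).symm
  rw [hexpand]
  calc c⁻¹ ^ 2 * ∑ a, ∑ b, cov a b
      ≤ c⁻¹ ^ 2 * (c * ((∏ i ∈ Sᶜ, (Fintype.card (J i) : ℝ)) * V)) := by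
        gcongr
        simpa [c] using sum_le_card_nsmul univ _ _ fun a _ => hrow a
    _ = (∏ i ∈ S, (Fintype.card (J i) : ℝ))⁻¹ * V := by
        have hS := prod_card_ne_zero (J := J) S
        have hSc := prod_card_ne_zero (J := J) Sᶜ
        rw [hc]
        field_simp

lemma expectation_norm_sq_sampleMean_hoeffding_le [∀ i, Nonempty (J i)] (hq0 : ∀ i a, 0 ≤ q i a)
    (hq : ∀ i, ∑ a, q i a = 1) (S : Finset ι) (g : (∀ i, X i) → H) :
    (expectation (fun s : Σ i, J i => q s.1) fun ω => ‖sampleMean (hoeffding q S g) ω‖ ^ 2)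
      ≤ (2 ^ #S) ^ 2 *
        ((∏ i ∈ S, (Fintype.card (J i) : ℝ))⁻¹ * expectation q fun y => ‖g y‖ ^ 2) := by
  have hcomponent : (expectation q fun y => ‖hoeffding q S g y‖ ^ 2)
      ≤ (2 ^ #S) ^ 2 * expectation q fun y => ‖g y‖ ^ 2 := by
    rw [← smul_eq_mul, ← map_smul]
    refine (expectation_map_hoeffding_le hq0 hq
      (convexOn_univ_norm.pow (fun _ _ => norm_nonneg _) 2) (fun v => by simp) S g).trans_eq ?_
    congr 1 with y
    simp [norm_smul, mul_pow]
  refine (expectation_norm_sq_sampleMean_le hq0 hq fun i hi =>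
    average_compl_singleton_hoeffding hq hi g).trans ?_
  rw [mul_left_comm]
  gcongr

lemma expectation_seminorm_sampleMean_hoeffding_le {E : Type*} [AddCommGroup E] [Module ℝ E]
    [∀ i, Nonempty (J i)] (hq0 : ∀ i a, 0 ≤ q i a) (hq : ∀ i, ∑ a, q i a = 1) (S : Finset ι)
    (N : Seminorm ℝ E) (f : (∀ i, X i) → E) :
    (expectation (fun s : Σ i, J i => q s.1) fun ω => N (sampleMean (hoeffding q S f) ω))
      ≤ 2 ^ #S * expectation q fun y => N (f y) := by
  refine (expectation_map_sampleMean_le hq0 hq N.convexOn _).trans ?_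
  refine (expectation_map_hoeffding_le hq0 hq N.convexOn (map_neg_eq_map N) S f).trans_eq ?_
  rw [← smul_eq_mul, ← map_smul]
  congr 1 with y
  simp [map_smul_eq_mul]

lemma expectation_norm_sampleMean_hoeffding_le [∀ i, Nonempty (J i)] (hq0 : ∀ i a, 0 ≤ q i a)
    (hq : ∀ i, ∑ a, q i a = 1) (S : Finset ι) (g : (∀ i, X i) → H) :
    (expectation (fun s : Σ i, J i => q s.1) fun ω => ‖sampleMean (hoeffding q S g) ω‖)
      ≤ 2 ^ #S *
        √((∏ i ∈ S, (Fintype.card (J i) : ℝ))⁻¹ * expectation q fun y => ‖g y‖ ^ 2) := by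
  rw [← Real.sqrt_sq (show (0 : ℝ) ≤ 2 ^ #S by positivity), ← Real.sqrt_mul (by positivity)]
  refine Real.le_sqrt_of_sq_le ?_
  refine le_trans ?_ (expectation_norm_sq_sampleMean_hoeffding_le hq0 hq S g)
  exact map_expectation_le_of_convexOn (fun s => hq0 s.1) (fun s => hq s.1) (even_two.convexOn_pow)
    fun ω => ‖sampleMean (hoeffding q S g) ω‖

lemma expectation_seminorm_sampleMean_hoeffding_le_of_approx {E : Type*} [AddCommGroup E]
    [Module ℝ E] [∀ i, Nonempty (J i)] (hq0 : ∀ i a, 0 ≤ q i a) (hq : ∀ i, ∑ a, q i a = 1)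
    (S : Finset ι) (N : Seminorm ℝ E) {K : H →ₗ[ℝ] E} {C : ℝ} (hC : 0 ≤ C)
    (hK : ∀ v, N (K v) ≤ C * ‖v‖) (f : (∀ i, X i) → E) (g : (∀ i, X i) → H) :
    (expectation (fun s : Σ i, J i => q s.1) fun ω => N (sampleMean (hoeffding q S f) ω))
      ≤ 2 ^ #S * ((expectation q fun y => N (average q S f y - K (g y)))
        + C * √((∏ i ∈ S, (Fintype.card (J i) : ℝ))⁻¹ * expectation q fun y => ‖g y‖ ^ 2)) := by
  have hsplit (ω : ∀ s : Σ i, J i, X s.1) : sampleMean (hoeffding q S f) ω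
      = sampleMean (hoeffding q S fun y => average q S f y - K (g y)) ω
        + K (sampleMean (hoeffding q S g) ω) := by
    have hK : (fun y => K (hoeffding q S g y)) = hoeffding q S fun y => K (g y) :=
      funext (map_hoeffding K S g)
    have hsub : (fun y => average q S f y - K (g y)) = average q S f - fun y => K (g y) := rfl
    rw [map_sampleMean, hK, hsub, map_sub, map_sub, hoeffding_average hq, Pi.sub_apply,
      sub_add_cancel]
  have hpoint (ω : ∀ s : Σ i, J i, X s.1) : N (sampleMean (hoeffding q S f) ω)
      ≤ N (sampleMean (hoeffding q S fun y => average q S f y - K (g y)) ω)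
        + C • ‖sampleMean (hoeffding q S g) ω‖ := by
    rw [hsplit]
    exact (map_add_le_add N _ _).trans (add_le_add_right (hK _) _)
  refine (expectation_mono (fun s => hq0 s.1) hpoint).trans ?_
  refine (map_add (expectation fun s : Σ i, J i => q s.1) _
    (C • fun ω => ‖sampleMean (hoeffding q S g) ω‖)).trans_le ?_
  rw [map_smul, smul_eq_mul, mul_add, mul_left_comm]
  exact add_le_add (expectation_seminorm_sampleMean_hoeffding_le hq0 hq S N _)
    (mul_le_mul_of_nonneg_left (expectation_norm_sampleMean_hoeffding_le hq0 hq S g) hC)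

end Variance

section MatrixNorms

open Matrix

variable {n : Type*}

/-- The entries of a matrix as a vector, an isometry from the Schatten 2-norm to a
Hilbert space norm. -/
def euclideanVec : Matrix n n ℂ ≃ₗ[ℝ] EuclideanSpace ℂ (n × n) :=
  (LinearEquiv.curry ℝ ℂ n n ≪≫ₗ Matrix.ofLinearEquiv ℝ).symm ≪≫ₗ
    (WithLp.linearEquiv 2 ℝ (n × n → ℂ)).symm

lemma euclideanVec_apply (A : Matrix n n ℂ) (i : n × n) : euclideanVec A i = A i.1 i.2 :=
  rfl

variable [Fintype n]

lemma inner_euclideanVec (A B : Matrix n n ℂ) :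
    inner ℝ (euclideanVec A) (euclideanVec B) = (Aᴴ * B).trace.re := by
  simp only [PiLp.inner_apply, euclideanVec_apply, Fintype.sum_prod_type_right, trace, diag,
    mul_apply, conjTranspose_apply, Complex.re_sum]
  refine Finset.sum_congr rfl fun i _ => Finset.sum_congr rfl fun j _ => ?_
  simp [Complex.inner, mul_comm]

lemma norm_euclideanVec (A : Matrix n n ℂ) : ‖euclideanVec A‖ = schattenTwo A := by
  rw [norm_eq_sqrt_real_inner, inner_euclideanVec, schattenTwo]

lemma schattenTwo_nonneg (A : Matrix n n ℂ) : 0 ≤ schattenTwo A := Real.sqrt_nonneg _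

lemma schattenTwo_sq (A : Matrix n n ℂ) : schattenTwo A ^ 2 = (Aᴴ * A).trace.re := by
  rw [← norm_euclideanVec, ← real_inner_self_eq_norm_sq, inner_euclideanVec]

lemma schattenTwo_conjTranspose (A : Matrix n n ℂ) : schattenTwo Aᴴ = schattenTwo A := by
  rw [schattenTwo, schattenTwo, conjTranspose_conjTranspose, trace_mul_comm]

lemma abs_re_trace_mul_le (A B : Matrix n n ℂ) :
    |(A * B).trace.re| ≤ schattenTwo A * schattenTwo B := by
  rw [← schattenTwo_conjTranspose A, ← norm_euclideanVec, ← norm_euclideanVec]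
  simpa [inner_euclideanVec] using abs_real_inner_le_norm (euclideanVec Aᴴ) (euclideanVec B)

variable [DecidableEq n]

lemma schattenTwo_unitary_mul (U : unitaryGroup n ℂ) (A : Matrix n n ℂ) :
    schattenTwo ((U : Matrix n n ℂ) * A) = schattenTwo A := by
  have hU : (U : Matrix n n ℂ)ᴴ * (U : Matrix n n ℂ) = 1 := Unitary.coe_star_mul_self U
  rw [schattenTwo, schattenTwo, conjTranspose_mul, Matrix.mul_assoc, ← Matrix.mul_assoc _ _ A, hU,
    Matrix.one_mul]

lemma bddAbove_abs_re_trace_unitary_mul (A : Matrix n n ℂ) :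
    BddAbove (Set.range fun U : unitaryGroup n ℂ => |((U : Matrix n n ℂ) * A).trace.re|) := by
  refine ⟨schattenTwo A * schattenTwo (1 : Matrix n n ℂ), ?_⟩
  rintro _ ⟨U, rfl⟩
  simpa [schattenTwo_unitary_mul] using abs_re_trace_mul_le ((U : Matrix n n ℂ) * A) 1

/-- The trace norm in its dual form `A ↦ sup_U |Re Tr (U A)|`, over the unitary matrices `U`. -/
def traceSeminorm (n : Type*) [Fintype n] [DecidableEq n] : Seminorm ℝ (Matrix n n ℂ) :=
  Seminorm.of (fun A => ⨆ U : unitaryGroup n ℂ, |((U : Matrix n n ℂ) * A).trace.re|)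
    (fun A B => ciSup_le fun U => by
      rw [Matrix.mul_add, trace_add, Complex.add_re]
      exact (abs_add_le _ _).trans (add_le_add (le_ciSup (bddAbove_abs_re_trace_unitary_mul A) U)
        (le_ciSup (bddAbove_abs_re_trace_unitary_mul B) U)))
    (fun c A => by simp [abs_mul, Real.mul_iSup_of_nonneg])

lemma abs_re_trace_unitary_mul_le (U : unitaryGroup n ℂ) (A : Matrix n n ℂ) :
    |((U : Matrix n n ℂ) * A).trace.re| ≤ traceSeminorm n A :=
  le_ciSup (bddAbove_abs_re_trace_unitary_mul A) U

lemma traceSeminorm_mul_le (A B : Matrix n n ℂ) :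
    traceSeminorm n (A * B) ≤ schattenTwo A * schattenTwo B :=
  ciSup_le fun U => by
    rw [← Matrix.mul_assoc, ← schattenTwo_unitary_mul U A]
    exact abs_re_trace_mul_le _ _

end MatrixNorms

section FunctionalCalculus

open Matrix

variable {n : Type*} [Fintype n] [DecidableEq n]

lemma continuousOn_spectrum (f : ℝ → ℝ) (A : Matrix n n ℂ) : ContinuousOn f (spectrum ℝ A) :=
  A.finite_real_spectrum.continuousOn f

lemma cfc_mul_cfc (f g : ℝ → ℝ) (A : Matrix n n ℂ) :
    cfc f A * cfc g A = cfc (fun t => f t * g t) A :=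
  (cfc_mul f g A (continuousOn_spectrum f A) (continuousOn_spectrum g A)).symm

lemma conjTranspose_cfc (f : ℝ → ℝ) (A : Matrix n n ℂ) : (cfc f A)ᴴ = cfc f A :=
  (cfc_predicate f A : IsSelfAdjoint _)

lemma schattenTwo_cfc_sq (f : ℝ → ℝ) (A : Matrix n n ℂ) :
    schattenTwo (cfc f A) ^ 2 = (cfc (fun t => f t ^ 2) A).trace.re := by
  rw [schattenTwo_sq, conjTranspose_cfc, cfc_mul_cfc]
  simp only [sq]

variable {A : Matrix n n ℂ}

lemma cfc_eq_self {f : ℝ → ℝ} (hA : A.IsHermitian) (hf : ∀ t ∈ spectrum ℝ A, f t = t) :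
    cfc f A = A :=
  (cfc_congr hf).trans (cfc_id' ℝ A hA.isSelfAdjoint)

lemma schattenOne_eq_trace_cfc_abs (hA : A.IsHermitian) :
    schattenOne A = (cfc (fun t : ℝ => |t|) A).trace.re := by
  have hsq : Aᴴ * A = cfc (fun t : ℝ => t ^ 2) A := by
    rw [cfc_pow_id A 2 hA.isSelfAdjoint, hA.eq, sq]
  rw [schattenOne, hsq, ← cfc_comp' _ _ A Real.continuous_sqrt.continuousOn
    (continuousOn_spectrum _ A) hA.isSelfAdjoint]
  simp only [Real.sqrt_sq_eq_abs]

lemma traceSeminorm_le_schattenOne (hA : A.IsHermitian) : traceSeminorm n A ≤ schattenOne A := by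
  set B := cfc (fun t : ℝ => √|t|) A
  set C := cfc (fun t : ℝ => t / √|t|) A
  have hfactor : B * C = A := by
    rw [cfc_mul_cfc]
    exact cfc_eq_self hA fun t _ => mul_div_cancel_of_imp' (by simp)
  have hB : schattenTwo B ^ 2 = schattenOne A := by
    simp only [B, schattenTwo_cfc_sq, Real.sq_sqrt (abs_nonneg _), schattenOne_eq_trace_cfc_abs hA]
  have hC : schattenTwo C ^ 2 = schattenOne A := by
    have hsq (t : ℝ) : (t / √|t|) ^ 2 = |t| := by
      rw [div_pow, Real.sq_sqrt (abs_nonneg t), ← sq_abs, sq, mul_self_div_self]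
    simp only [C, schattenTwo_cfc_sq, hsq, schattenOne_eq_trace_cfc_abs hA]
  calc traceSeminorm n A = traceSeminorm n (B * C) := by rw [hfactor]
    _ ≤ schattenTwo B * schattenTwo C := traceSeminorm_mul_le B C
    _ ≤ schattenOne A := by linarith [two_mul_le_add_sq (schattenTwo B) (schattenTwo C)]

lemma exists_unitary_re_trace_mul_eq_schattenOne (hA : A.IsHermitian) :
    ∃ U : unitaryGroup n ℂ, ((U : Matrix n n ℂ) * A).trace.re = schattenOne A := by
  let σ : ℝ → ℝ := fun t => if 0 ≤ t then 1 else -1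
  have hσ (t : ℝ) : σ t * σ t = 1 := by
    dsimp only [σ]
    split_ifs <;> norm_num
  have hunitary : cfc σ A ∈ unitaryGroup n ℂ := by
    rw [mem_unitaryGroup_iff, star_eq_conjTranspose, conjTranspose_cfc, cfc_mul_cfc]
    simp only [hσ, cfc_const_one ℝ A hA.isSelfAdjoint]
  have habs : cfc σ A * A = cfc (fun t : ℝ => |t|) A := by
    nth_rw 2 [← cfc_id' ℝ A hA.isSelfAdjoint]
    rw [cfc_mul_cfc]
    congr 1 with t
    obtain ht | ht := le_or_gt 0 t
    · simp [σ, ht, abs_of_nonneg ht]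
    · simp [σ, ht.not_ge, abs_of_neg ht]
  exact ⟨⟨_, hunitary⟩, by rw [schattenOne_eq_trace_cfc_abs hA, ← habs]⟩

lemma schattenOne_eq_traceSeminorm (hA : A.IsHermitian) : schattenOne A = traceSeminorm n A := by
  obtain ⟨U, hU⟩ := exists_unitary_re_trace_mul_eq_schattenOne hA
  exact (hU.ge.trans ((le_abs_self _).trans (abs_re_trace_unitary_mul_le U A))).antisymm
    (traceSeminorm_le_schattenOne hA)

end FunctionalCalculus

section Kronecker

open Matrix

variable {n : Type*} [Fintype n] [DecidableEq n]

lemma cfc_algHom_apply {ι : Type*} [Finite ι] (φ : (ι → ℝ) →ₐ[ℝ] Matrix n n ℂ) (f : ℝ → ℝ)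
    (e : ι → ℝ) (he : (φ e).IsHermitian) : cfc f (φ e) = φ (f ∘ e) := by
  cases nonempty_fintype ι
  let P := Lagrange.interpolate (Finset.univ.image e) id f
  have hP (i : ι) : P.eval (e i) = f (e i) :=
    Lagrange.eval_interpolate_at_node f (v := id) (Set.injOn_id _)
      (Finset.mem_image_of_mem e (Finset.mem_univ i))
  have hspec : Set.EqOn f P.eval (spectrum ℝ (φ e)) := fun t ht => by
    have ht := AlgHom.spectrum_apply_subset φ e ht
    rw [Pi.spectrum_eq, Set.mem_iUnion] at ht
    obtain ⟨i, hi⟩ := ht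
    obtain rfl : t = e i := (spectrum.scalar_eq (e i)).subset hi
    exact (hP i).symm
  rw [cfc_congr hspec, cfc_polynomial P _ he.isSelfAdjoint, Polynomial.aeval_algHom_apply]
  congr 1 with i
  simp [hP]

lemma cfc_unitary_conj_diagonal {V : Matrix n n ℂ} (hV : V ∈ unitaryGroup n ℂ) (f : ℝ → ℝ)
    (e : n → ℝ) :
    cfc f (V * diagonal (fun i => (e i : ℂ)) * Vᴴ) =
      V * diagonal (fun i => (f (e i) : ℂ)) * Vᴴ :=
  cfc_algHom_apply ((Unitary.conjStarAlgAut ℝ (Matrix n n ℂ) ⟨V, hV⟩).toAlgEquiv.toAlgHom.comp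
      ((diagonalAlgHom ℝ).comp (Complex.ofRealAm.compLeft n))) f e
    (isHermitian_mul_mul_conjTranspose _
      (isHermitian_diagonal_of_self_adjoint _ <| funext fun _ => Complex.conj_ofReal _))

lemma invFourthRoot_eq_cfc (A : Matrix n n ℂ) :
    invFourthRoot A = cfc (fun t : ℝ => t ^ (-(1 / 4) : ℝ)) A := by
  rw [invFourthRoot]
  congr 1 with t
  split_ifs with ht
  · simp [ht, Real.zero_rpow]
  · rfl

lemma invFourthRoot_kronecker {Y : Type*} [Fintype Y] [DecidableEq Y] {c : Y → ℝ}
    (hc : ∀ u, 0 ≤ c u) {R : Matrix n n ℂ} (hR : R.PosSemidef) :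
    invFourthRoot (diagonal (fun u => (c u : ℂ)) ⊗ₖ R) =
      diagonal (fun u => ((c u ^ (-(1 / 4) : ℝ) : ℝ) : ℂ)) ⊗ₖ invFourthRoot R := by
  set e := hR.isHermitian.eigenvalues
  obtain ⟨V, hV, hdiag⟩ : ∃ V ∈ unitaryGroup n ℂ, R = V * diagonal (fun i => (e i : ℂ)) * Vᴴ :=
    ⟨_, hR.isHermitian.eigenvectorUnitary.2, hR.isHermitian.spectral_theorem⟩
  have hW : (1 : Matrix Y Y ℂ) ⊗ₖ V ∈ unitaryGroup (Y × n) ℂ :=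
    kronecker_mem_unitary (one_mem _) hV
  have hkron (a : Y → ℝ) (b : n → ℝ) :
      diagonal (fun u => (a u : ℂ)) ⊗ₖ (V * diagonal (fun i => (b i : ℂ)) * Vᴴ) =
        (1 ⊗ₖ V) * diagonal (fun s => ((a s.1 * b s.2 : ℝ) : ℂ)) * (1 ⊗ₖ V)ᴴ := by
    simp only [conjTranspose_kronecker, conjTranspose_one, Complex.ofReal_mul]
    rw [← diagonal_kronecker_diagonal (fun u => (a u : ℂ)) (fun i => (b i : ℂ)),
      ← mul_kronecker_mul, ← mul_kronecker_mul, Matrix.one_mul, Matrix.mul_one]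
  rw [hdiag, hkron, invFourthRoot_eq_cfc, invFourthRoot_eq_cfc, cfc_unitary_conj_diagonal hW,
    cfc_unitary_conj_diagonal hV, hkron]
  simp only [e, Real.mul_rpow (hc _) (hR.eigenvalues_nonneg _)]

end Kronecker

section Roots

open Matrix

variable {n : Type*} [Fintype n] [DecidableEq n]

/-- The fourth root of a positive semidefinite matrix, inverse to `invFourthRoot` on the
support. -/
def fourthRoot (R : Matrix n n ℂ) : Matrix n n ℂ := cfc (fun t : ℝ => t ^ (1 / 4 : ℝ)) R

lemma conjTranspose_fourthRoot (R : Matrix n n ℂ) : (fourthRoot R)ᴴ = fourthRoot R :=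
  conjTranspose_cfc _ R

lemma conjTranspose_invFourthRoot (R : Matrix n n ℂ) : (invFourthRoot R)ᴴ = invFourthRoot R :=
  conjTranspose_cfc _ R

lemma traceSeminorm_mul_mul_le {r : Matrix n n ℂ} (hr : rᴴ = r) (C : Matrix n n ℂ) :
    traceSeminorm n (r * C * r) ≤ schattenTwo (r * r) * schattenTwo C :=
  ciSup_le fun U => by
    have hU : schattenTwo (r * (U : Matrix n n ℂ) * r) ≤ schattenTwo (r * r) := by
      refine le_of_sq_le_sq ?_ (schattenTwo_nonneg _)
      have hcyc : ((r * (U : Matrix n n ℂ) * r)ᴴ * (r * U * r)).trace =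
          ((star U : unitaryGroup n ℂ) * (r * r) * (U * (r * r))).trace := by
        rw [conjTranspose_mul, conjTranspose_mul, hr, Matrix.mul_assoc, trace_mul_comm]
        simp only [Matrix.mul_assoc]
        rfl
      rw [schattenTwo_sq, hcyc]
      refine (le_abs_self _).trans ((abs_re_trace_mul_le _ _).trans_eq ?_)
      rw [schattenTwo_unitary_mul, schattenTwo_unitary_mul, sq]
    have hcyc : ((U : Matrix n n ℂ) * (r * C * r)).trace = (r * U * r * C).trace := by
      rw [← Matrix.mul_assoc, trace_mul_comm]
      simp only [Matrix.mul_assoc]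
    rw [hcyc]
    exact (abs_re_trace_mul_le _ _).trans (mul_le_mul_of_nonneg_right hU (schattenTwo_nonneg C))

variable {R : Matrix n n ℂ}

lemma spectrum_nonneg (hR : R.PosSemidef) {t : ℝ} (ht : t ∈ spectrum ℝ R) : 0 ≤ t := by
  obtain ⟨i, rfl⟩ := hR.isHermitian.spectrum_real_eq_range_eigenvalues.subset ht
  exact hR.eigenvalues_nonneg i

lemma schattenTwo_fourthRoot_mul_self (hR : R.PosSemidef) :
    schattenTwo (fourthRoot R * fourthRoot R) = √R.trace.re := by
  have hpow : ∀ t ∈ spectrum ℝ R, (t ^ (1 / 4 : ℝ) * t ^ (1 / 4 : ℝ)) ^ 2 = t := fun t ht => by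
    rw [← sq, ← pow_mul, ← Real.rpow_natCast, ← Real.rpow_mul (spectrum_nonneg hR ht)]
    norm_num
  rw [← Real.sqrt_sq (schattenTwo_nonneg _), fourthRoot, cfc_mul_cfc, schattenTwo_cfc_sq,
    cfc_eq_self hR.isHermitian hpow]

lemma fourthRoot_mul_invFourthRoot_mul (hR : R.PosSemidef) :
    fourthRoot R * invFourthRoot R * R = R := by
  have hpow : ∀ t ∈ spectrum ℝ R, t ^ (1 / 4 : ℝ) * t ^ (-(1 / 4) : ℝ) * t = t := fun t ht => by
    obtain rfl | hpos := (spectrum_nonneg hR ht).eq_or_lt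
    · simp
    · rw [← Real.rpow_add hpos]
      norm_num
  nth_rw 3 [← cfc_id' ℝ R hR.isHermitian.isSelfAdjoint]
  rw [fourthRoot, invFourthRoot_eq_cfc, cfc_mul_cfc, cfc_mul_cfc, cfc_eq_self hR.isHermitian hpow]

end Roots

section Blocks

open Matrix

variable {Y n : Type*}

/-- The diagonal block at `u` of a matrix on `Y × n`, that is `⟨u| α |u⟩`. -/
def block (α : Matrix (Y × n) (Y × n) ℂ) (u : Y) : Matrix n n ℂ :=
  α.submatrix (Prod.mk u) (Prod.mk u)

lemma isHermitian_block {α : Matrix (Y × n) (Y × n) ℂ} (hα : α.IsHermitian) (u : Y) :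
    (block α u).IsHermitian :=
  hα.submatrix _

variable [Fintype Y] [Fintype n]

lemma sum_schattenTwo_sq_block_le (α : Matrix (Y × n) (Y × n) ℂ) :
    ∑ u, schattenTwo (block α u) ^ 2 ≤ schattenTwo α ^ 2 := by
  simp only [← norm_euclideanVec, EuclideanSpace.norm_sq_eq, Fintype.sum_prod_type]
  gcongr with u _ a _
  exact Finset.single_le_sum (f := fun v => ∑ b, ‖α (u, a) (v, b)‖ ^ 2)
    (fun v _ => by positivity) (Finset.mem_univ u)

variable [DecidableEq Y]

lemma block_kronecker_mul (d : Y → ℂ) (P : Matrix n n ℂ) (α : Matrix (Y × n) (Y × n) ℂ) (u : Y) :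
    block ((diagonal d ⊗ₖ P) * α) u = d u • (P * block α u) := by
  ext a b
  simp [block, mul_apply, Fintype.sum_prod_type, diagonal_apply, Finset.mul_sum, mul_assoc]

lemma block_mul_kronecker (d : Y → ℂ) (P : Matrix n n ℂ) (α : Matrix (Y × n) (Y × n) ℂ) (u : Y) :
    block (α * (diagonal d ⊗ₖ P)) u = d u • (block α u * P) := by
  ext a b
  simp [block, mul_apply, Fintype.sum_prod_type, diagonal_apply, Finset.mul_sum, mul_left_comm]

variable [DecidableEq n]

lemma blockDiagonal_mem_unitary (U : Y → unitaryGroup n ℂ) :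
    blockDiagonal (fun u => (U u : Matrix n n ℂ)) ∈ unitaryGroup (n × Y) ℂ := by
  rw [mem_unitaryGroup_iff, star_eq_conjTranspose, blockDiagonal_conjTranspose,
    ← blockDiagonal_mul]
  simp [← star_eq_conjTranspose, ← Pi.one_def]

lemma sum_schattenOne_block_le {α : Matrix (Y × n) (Y × n) ℂ} (hα : α.IsHermitian) :
    ∑ u, schattenOne (block α u) ≤ schattenOne α := by
  choose U hU using fun u => exists_unitary_re_trace_mul_eq_schattenOne (isHermitian_block hα u)
  let e := Equiv.prodComm Y n
  let W := (blockDiagonal fun u => (U u : Matrix n n ℂ)).submatrix e e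
  have hW : W ∈ unitaryGroup (Y × n) ℂ := by
    rw [mem_unitaryGroup_iff, star_eq_conjTranspose, conjTranspose_submatrix, submatrix_mul_equiv,
      ← star_eq_conjTranspose, mem_unitaryGroup_iff.1 (blockDiagonal_mem_unitary U),
      submatrix_one_equiv]
  have htrace : (W * α).trace = ∑ u, ((U u : Matrix n n ℂ) * block α u).trace := by
    simp [trace, mul_apply, Fintype.sum_prod_type, W, e, block, blockDiagonal_apply]
  calc ∑ u, schattenOne (block α u) = (W * α).trace.re := by simp only [htrace, Complex.re_sum, hU]
    _ ≤ traceSeminorm (Y × n) α := (le_abs_self _).trans (abs_re_trace_unitary_mul_le ⟨W, hW⟩ α)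
    _ = schattenOne α := (schattenOne_eq_traceSeminorm hα).symm

lemma mul_eq_self_of_supp_le {α β P : Matrix n n ℂ} (h : supp α ≤ supp β) (hP : P * β = β) :
    P * α = α := by
  refine toLin'.injective (LinearMap.ext fun v => ?_)
  obtain ⟨w, hw⟩ := h ⟨v, rfl⟩
  rw [toLin'_mul, LinearMap.comp_apply, ← hw, ← LinearMap.comp_apply, ← toLin'_mul, hP]

variable {R : Matrix n n ℂ} {α : Matrix (Y × n) (Y × n) ℂ}

lemma fourthRoot_mul_invFourthRoot_mul_block (hR : R.PosSemidef) {β : Matrix Y Y ℂ}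
    (h : supp α ≤ supp (β ⊗ₖ R)) (u : Y) :
    fourthRoot R * invFourthRoot R * block α u = block α u := by
  have hP : (diagonal 1 ⊗ₖ (fourthRoot R * invFourthRoot R)) * (β ⊗ₖ R) = β ⊗ₖ R := by
    rw [← mul_kronecker_mul, fourthRoot_mul_invFourthRoot_mul hR, Pi.one_def, diagonal_one,
      Matrix.one_mul]
  have hblock := congrArg (block · u) (mul_eq_self_of_supp_le h hP)
  simpa only [block_kronecker_mul, Pi.one_apply, one_smul] using hblock

lemma fourthRoot_conj_block (hR : R.PosSemidef) {β : Matrix Y Y ℂ} (hα : α.IsHermitian)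
    (h : supp α ≤ supp (β ⊗ₖ R)) (u : Y) :
    fourthRoot R * (invFourthRoot R * block α u * invFourthRoot R) * fourthRoot R = block α u := by
  have hleft := fourthRoot_mul_invFourthRoot_mul_block hR h u
  have hright : block α u * (invFourthRoot R * fourthRoot R) = block α u := by
    have := congrArg conjTranspose hleft
    rwa [conjTranspose_mul, conjTranspose_mul, isHermitian_block hα u, conjTranspose_fourthRoot,
      conjTranspose_invFourthRoot] at this
  calc _ = fourthRoot R * invFourthRoot R * block α u * (invFourthRoot R * fourthRoot R) := by
        simp only [Matrix.mul_assoc]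
    _ = block α u := by rw [hleft, hright]

lemma sum_inv_mul_schattenTwo_sq_block_le (hR : R.PosSemidef) {c : Y → ℝ} (hc : ∀ u, 0 ≤ c u)
    (α : Matrix (Y × n) (Y × n) ℂ) :
    ∑ u, (c u)⁻¹ * schattenTwo (invFourthRoot R * block α u * invFourthRoot R) ^ 2 ≤
      schattenTwo (invFourthRoot (diagonal (fun u => (c u : ℂ)) ⊗ₖ R) * α *
        invFourthRoot (diagonal (fun u => (c u : ℂ)) ⊗ₖ R)) ^ 2 := by
  refine le_of_eq_of_le (Finset.sum_congr rfl fun u _ => ?_) (sum_schattenTwo_sq_block_le _)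
  have hpow : (c u ^ (-(1 / 4) : ℝ)) ^ 4 = (c u)⁻¹ := by
    rw [← Real.rpow_natCast, ← Real.rpow_mul (hc u), ← Real.rpow_neg_one]
    norm_num
  rw [invFourthRoot_kronecker hc hR, block_mul_kronecker, block_kronecker_mul, smul_mul, smul_smul,
    ← Complex.ofReal_mul, Complex.coe_smul, ← norm_euclideanVec, ← norm_euclideanVec, map_smul,
    norm_smul, mul_pow, Real.norm_eq_abs, sq_abs, ← sq, ← pow_mul, hpow]

end Blocks

section PartialTrace

open Matrix

variable {k : ℕ} {X : Fin k → Type*} [∀ i, Fintype (X i)] {m : Type*}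

lemma isHermitian_reduceTo (S : Finset (Fin k)) {M : Matrix ((∀ i, X i) × m) ((∀ i, X i) × m) ℂ}
    (hM : M.IsHermitian) : (reduceTo S M).IsHermitian := by
  ext u v
  simp only [reduceTo, conjTranspose_apply, of_apply, star_sum, hM.apply]

variable [Fintype m]

lemma trace_reduceToM (M : Matrix ((∀ i, X i) × m) ((∀ i, X i) × m) ℂ) :
    (reduceToM M).trace = M.trace := by
  simp only [trace, diag_apply, reduceToM, of_apply, Fintype.sum_prod_type_right]

lemma trace_reduceTo (S : Finset (Fin k)) (M : Matrix ((∀ i, X i) × m) ((∀ i, X i) × m) ℂ) :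
    (reduceTo S M).trace = M.trace := by
  simp only [trace, diag_apply, reduceTo, of_apply, Fintype.sum_prod_type]
  rw [← (Equiv.piEquivPiSubtypeProd (· ∈ S) X).symm.sum_comp, Fintype.sum_prod_type]
  exact Finset.sum_congr rfl fun u _ => Finset.sum_comm

end PartialTrace

section ControlState

open Matrix

variable {k : ℕ} {X : Fin k → Type*} [∀ i, Fintype (X i)] [∀ i, DecidableEq (X i)] {m : Type*}
  {p : (∀ i, X i) → ℝ} {ρ : (∀ i, X i) → Matrix m m ℂ}

lemma controlState_apply (x y : ∀ i, X i) (a b : m) :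
    controlState p ρ (x, a) (y, b) = if x = y then p x • ρ x a b else 0 := by
  simp only [controlState, Matrix.sum_apply, Matrix.smul_apply, kroneckerMap_apply, single_apply]
  rw [Finset.sum_eq_single x]
  · by_cases h : x = y <;> simp [h]
  · intro z _ hz
    simp [hz]
  · simp

lemma reduceToM_controlState : reduceToM (controlState p ρ) = ∑ x, p x • ρ x := by
  ext a b
  simp [reduceToM, controlState_apply, Matrix.sum_apply]

lemma posSemidef_reduceToM_controlState (hp : ∀ x, 0 ≤ p x) (hρ : ∀ x, (ρ x).PosSemidef) :
    (reduceToM (controlState p ρ)).PosSemidef := by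
  rw [reduceToM_controlState]
  exact Matrix.posSemidef_sum _ fun x _ => (hρ x).smul (hp x)

lemma isHermitian_controlState (hρ : ∀ x, (ρ x).IsHermitian) :
    (controlState p ρ).IsHermitian := by
  ext ⟨x, a⟩ ⟨y, b⟩
  rw [conjTranspose_apply, controlState_apply, controlState_apply]
  by_cases h : x = y
  · subst h
    simp [← (hρ x).apply a b]
  · simp [h, Ne.symm h]

lemma block_reduceTo_controlState (S : Finset (Fin k)) (u : ∀ i : {i // i ∈ S}, X i) :
    block (reduceTo S (controlState p ρ)) u
      = ∑ z, (p ((Equiv.piEquivPiSubtypeProd (· ∈ S) X).symm (u, z))) •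
          ρ ((Equiv.piEquivPiSubtypeProd (· ∈ S) X).symm (u, z)) := by
  ext a b
  simp [block, reduceTo, controlState_apply, Matrix.sum_apply]

end ControlState

section Marginals

variable {ι : Type*} {X : ι → Type*} {q : ∀ i, X i → ℝ}

/-- The weight `∏ i ∈ S, q i (u i)` of a point with coordinates in `S` only. -/
def weightOn (q : ∀ i, X i → ℝ) (S : Finset ι) : (∀ i : {i // i ∈ S}, X i) → ℝ :=
  weight fun i => q i

lemma weightOn_nonneg (hq0 : ∀ i a, 0 ≤ q i a) (S : Finset ι) (u : ∀ i : {i // i ∈ S}, X i) :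
    0 ≤ weightOn q S u :=
  weight_nonneg (fun i => hq0 i.1) u

variable [Fintype ι] [DecidableEq ι]

lemma weight_piEquivPiSubtypeProd_symm (S : Finset ι) (u : ∀ i : {i // i ∈ S}, X i)
    (z : ∀ i : {i // i ∉ S}, X i) :
    weight q ((Equiv.piEquivPiSubtypeProd (· ∈ S) X).symm (u, z))
      = weightOn q S u * weight (fun i : {i // i ∉ S} => q i) z := by
  simp only [weightOn, weight]
  rw [← Fintype.prod_subtype_mul_prod_subtype (· ∈ S)]
  congr 1
  · refine Finset.prod_congr (by ext; simp) fun i _ => ?_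
    simp [Equiv.piEquivPiSubtypeProd, i.2]
  · refine Finset.prod_congr rfl fun i _ => ?_
    simp [Equiv.piEquivPiSubtypeProd, i.2]

variable [∀ i, Fintype (X i)]

lemma average_eq_expectation_compl {E : Type*} [AddCommGroup E] [Module ℝ E]
    (hq : ∀ i, ∑ a, q i a = 1) (S : Finset ι) (f : (∀ i, X i) → E) (y : ∀ i, X i) :
    average q S f y = expectation (fun i : {i // i ∉ S} => q i) fun z =>
      f ((Equiv.piEquivPiSubtypeProd (· ∈ S) X).symm (fun i => y i, z)) := by
  rw [average_apply, ← expectation_comp_injective hq Subtype.val_injective]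
  congr! 3 with z i

lemma expectation_inv_weightOn_mul_le (hq : ∀ i, ∑ a, q i a = 1) (S : Finset ι)
    {φ : (∀ i : {i // i ∈ S}, X i) → ℝ} (hφ : ∀ u, 0 ≤ φ u) :
    (expectation q fun y => (weightOn q S fun i => y i)⁻¹ * φ fun i => y i)
      ≤ ∑ u, φ u := by
  rw [expectation_comp_injective hq Subtype.val_injective
    fun u => (weightOn q S u)⁻¹ * φ u, expectation_apply]
  refine Finset.sum_le_sum fun u _ => ?_
  rw [smul_eq_mul, ← mul_assoc]
  exact mul_le_of_le_one_left (hφ u) mul_inv_le_one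

end Marginals

section Reweighted

variable {k : ℕ} {X : Fin k → Type*} {m : Type*}

/-- The summand `p(y) / q(y) • ρ_y` of the sample average, for the product weight `q(y)`. -/
def reweighted (p : (∀ i, X i) → ℝ) (q : ∀ i, X i → ℝ) (ρ : (∀ i, X i) → Matrix m m ℂ)
    (y : ∀ i, X i) : Matrix m m ℂ :=
  (p y / weight q y) • ρ y

lemma sampleAverage_eq_sampleMean {p : (∀ i, X i) → ℝ} {q : ∀ i, X i → ℝ}
    {ρ : (∀ i, X i) → Matrix m m ℂ} {A : Fin k → ℕ} (ω : ∀ s : Σ i, Fin (A i), X s.1) :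
    sampleAverage p q ρ A (fun i j => ω ⟨i, j⟩) = sampleMean (reweighted p q ρ) ω := by
  ext a b
  simp [sampleAverage, sampleMean_apply, reweighted, weight, Matrix.sum_apply]

lemma isHermitian_sampleAverage {p : (∀ i, X i) → ℝ} {q : ∀ i, X i → ℝ}
    {ρ : (∀ i, X i) → Matrix m m ℂ} {A : Fin k → ℕ} (hρ : ∀ x, (ρ x).IsHermitian)
    (x : ∀ i, Fin (A i) → X i) :
    (sampleAverage p q ρ A x).IsHermitian := by
  rw [sampleAverage_eq_sampleMean fun s => x s.1 s.2, sampleMean_apply]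
  exact ((IsSelfAdjoint.all _).smul (isSelfAdjoint_sum _ fun a _ =>
    (IsSelfAdjoint.all _).smul (hρ _).isSelfAdjoint)).isHermitian

variable [∀ i, Fintype (X i)]

lemma expectIID_eq_expectation {q : ∀ i, X i → ℝ} {A : Fin k → ℕ}
    (f : (∀ i, Fin (A i) → X i) → ℝ) :
    expectIID q A f = expectation (fun s : Σ i, Fin (A i) => q s.1) fun ω =>
      f fun i j => ω ⟨i, j⟩ := by
  rw [expectation_apply, expectIID,
    ← (Equiv.piCurry fun (i : Fin k) (_ : Fin (A i)) => X i).sum_comp]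
  simp only [weight, Fintype.prod_sigma]
  rfl

variable [∀ i, DecidableEq (X i)]
variable {p : (∀ i, X i) → ℝ} {q : ∀ i, X i → ℝ} {ρ : (∀ i, X i) → Matrix m m ℂ}

lemma eq_zero_of_weight_eq_zero (hp : ∀ y, 0 ≤ p y)
    (hsupp : ∀ i, Function.support (marginal p i) ⊆ Function.support (q i)) {y : ∀ i, X i}
    (hy : weight q y = 0) : p y = 0 := by
  obtain ⟨i, -, hi⟩ := Finset.prod_eq_zero_iff.1 hy
  have hmarginal : marginal p i (y i) = 0 := by
    by_contra hne
    exact hsupp i hne hi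
  exact (Finset.sum_eq_zero_iff_of_nonneg fun x _ => hp x).1 hmarginal y (by simp)

lemma expectation_reweighted (hac : ∀ y, weight q y = 0 → p y = 0) :
    expectation q (reweighted p q ρ) = reduceToM (controlState p ρ) := by
  rw [expectation_apply, reduceToM_controlState]
  refine Finset.sum_congr rfl fun y _ => ?_
  rw [reweighted, smul_smul, mul_div_cancel_of_imp' (hac y)]

lemma average_reweighted (hq : ∀ i, ∑ a, q i a = 1) (hac : ∀ y, weight q y = 0 → p y = 0)
    (S : Finset (Fin k)) (y : ∀ i, X i) :
    average q S (reweighted p q ρ) y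
      = (weightOn q S fun i => y i)⁻¹ •
          block (reduceTo S (controlState p ρ)) fun i => y i := by
  rw [average_eq_expectation_compl hq, expectation_apply, block_reduceTo_controlState,
    Finset.smul_sum]
  refine Finset.sum_congr rfl fun z _ => ?_
  rw [reweighted, smul_smul, smul_smul]
  congr 1
  by_cases hz : weight q ((Equiv.piEquivPiSubtypeProd (· ∈ S) X).symm (fun i => y i, z)) = 0
  · simp [hac _ hz]
  · rw [weight_piEquivPiSubtypeProd_symm] at hz ⊢
    have := left_ne_zero_of_mul hz
    have := right_ne_zero_of_mul hz
    field_simp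

end Reweighted

section Covering

open Matrix

variable {ι : Type*} [Fintype ι] [DecidableEq ι] {X : ι → Type*} [∀ i, Fintype (X i)]
  [∀ i, DecidableEq (X i)] {q : ∀ i, X i → ℝ}
variable {m : Type*} [Fintype m] [DecidableEq m] {S : Finset ι}
  {α γ : Matrix ((∀ i : {i // i ∈ S}, X i) × m) ((∀ i : {i // i ∈ S}, X i) × m) ℂ}

lemma expectation_traceSeminorm_inv_weightOn_smul_block_le (hq0 : ∀ i a, 0 ≤ q i a)
    (hq : ∀ i, ∑ a, q i a = 1) (hα : α.IsHermitian) :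
    (expectation q fun y => traceSeminorm m ((weightOn q S fun i => y i)⁻¹ • block α fun i => y i))
      ≤ schattenOne α := by
  refine le_trans (le_of_eq ?_) ((expectation_inv_weightOn_mul_le hq S
    (φ := fun u => traceSeminorm m (block α u)) fun u => apply_nonneg _ _).trans ?_)
  · congr 1 with y
    rw [map_smul_eq_mul, Real.norm_of_nonneg (inv_nonneg.2 (weightOn_nonneg hq0 S _))]
  · simp only [← schattenOne_eq_traceSeminorm (isHermitian_block hα _)]
    exact sum_schattenOne_block_le hα

lemma expectation_norm_sq_inv_weightOn_smul_block_le (hq0 : ∀ i a, 0 ≤ q i a)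
    (hq : ∀ i, ∑ a, q i a = 1) {R : Matrix m m ℂ} (hR : R.PosSemidef)
    {β : Matrix ((∀ i : {i // i ∈ S}, X i) × m) ((∀ i : {i // i ∈ S}, X i) × m) ℂ}
    (hβ : β = diagonal (fun u => (weightOn q S u : ℂ)) ⊗ₖ R) :
    (expectation q fun y => ‖(weightOn q S fun i => y i)⁻¹ •
        euclideanVec (invFourthRoot R * block α (fun i => y i) * invFourthRoot R)‖ ^ 2)
      ≤ schattenTwo (invFourthRoot β * α * invFourthRoot β) ^ 2 := by
  subst hβ
  refine le_trans (le_of_eq ?_) ((expectation_inv_weightOn_mul_le hq S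
    (φ := fun u => (weightOn q S u)⁻¹ *
      schattenTwo (invFourthRoot R * block α u * invFourthRoot R) ^ 2)
    fun u => mul_nonneg (inv_nonneg.2 (weightOn_nonneg hq0 S u)) (sq_nonneg _)).trans
      (sum_inv_mul_schattenTwo_sq_block_le hR (weightOn_nonneg hq0 S) α))
  congr 1 with y
  rw [norm_smul, mul_pow, norm_euclideanVec, Real.norm_eq_abs, sq_abs, sq, mul_assoc]

variable {J : ι → Type*} [∀ i, Fintype (J i)] [∀ i, DecidableEq (J i)] [∀ i, Nonempty (J i)]

lemma expectation_traceSeminorm_sampleMean_hoeffding_le (hq0 : ∀ i a, 0 ≤ q i a)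
    (hq : ∀ i, ∑ a, q i a = 1) {f : (∀ i, X i) → Matrix m m ℂ}
    (hf : ∀ y, average q S f y = (weightOn q S fun i => y i)⁻¹ • block γ fun i => y i)
    (hγ : γ.IsHermitian) (hα : α.IsHermitian) {R : Matrix m m ℂ} (hR : R.PosSemidef)
    {β : Matrix ((∀ i : {i // i ∈ S}, X i) × m) ((∀ i : {i // i ∈ S}, X i) × m) ℂ}
    (hβ : β = diagonal (fun u => (weightOn q S u : ℂ)) ⊗ₖ R) (hsupp : supp α ≤ supp β) :
    (expectation (fun s : Σ i, J i => q s.1) fun ω =>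
        traceSeminorm m (sampleMean (hoeffding q S f) ω))
      ≤ 2 ^ S.card * (schattenOne (γ - α) + √R.trace.re *
        √((∏ i ∈ S, (Fintype.card (J i) : ℝ))⁻¹ *
          schattenTwo (invFourthRoot β * α * invFourthRoot β) ^ 2)) := by
  let K : EuclideanSpace ℂ (m × m) →ₗ[ℝ] Matrix m m ℂ :=
    LinearMap.mulRight ℝ (fourthRoot R) ∘ₗ LinearMap.mulLeft ℝ (fourthRoot R) ∘ₗ
      euclideanVec.symm.toLinearMap
  let g (y : ∀ i, X i) := (weightOn q S fun i => y i)⁻¹ •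
    euclideanVec (invFourthRoot R * block α (fun i => y i) * invFourthRoot R)
  have hK (v : EuclideanSpace ℂ (m × m)) : traceSeminorm m (K v) ≤ √R.trace.re * ‖v‖ := by
    have hHolder := traceSeminorm_mul_mul_le (conjTranspose_fourthRoot R) (euclideanVec.symm v)
    rwa [schattenTwo_fourthRoot_mul_self hR, ← norm_euclideanVec,
      LinearEquiv.apply_symm_apply] at hHolder
  have hdiff (y : ∀ i, X i) : average q S f y - K (g y) =
      (weightOn q S fun i => y i)⁻¹ • block (γ - α) fun i => y i := by
    have hKg : K (g y) = (weightOn q S fun i => y i)⁻¹ • block α fun i => y i := by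
      simp [K, g, fourthRoot_conj_block hR hα (hβ ▸ hsupp)]
    rw [hf, hKg, ← smul_sub]
    rfl
  refine (expectation_seminorm_sampleMean_hoeffding_le_of_approx hq0 hq S (traceSeminorm m)
    (Real.sqrt_nonneg _) hK f g).trans ?_
  simp only [hdiff]
  gcongr
  · exact expectation_traceSeminorm_inv_weightOn_smul_block_le hq0 hq (hγ.sub hα)
  · exact expectation_norm_sq_inv_weightOn_smul_block_le hq0 hq hR hβ

end Covering

section Rate

variable {n : Type*} [Fintype n] [DecidableEq n]

lemma exists_of_smoothRenyiTwo_lt {ε : ℝ} {α β : Matrix n n ℂ} {l : ℝ}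
    (h : smoothRenyiTwo ε α β < (l : EReal)) :
    ∃ α', IsSubnormalised α' ∧ schattenOne (α' - α) ≤ ε * α.trace.re ∧ supp α' ≤ supp β ∧
      schattenTwo (invFourthRoot β * α' * invFourthRoot β) ^ 2 < 2 ^ l := by
  simp only [smoothRenyiTwo, iInf_lt_iff, Set.mem_ofPred_eq] at h
  obtain ⟨α', ⟨hα', hdist⟩, hlt⟩ := h
  unfold renyiTwo at hlt
  split_ifs at hlt with hsupp hzero
  · exact ⟨α', hα', hdist, hsupp, by rw [hzero, zero_pow two_ne_zero]; positivity⟩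
  · refine ⟨α', hα', hdist, hsupp, ?_⟩
    have hpos := lt_of_le_of_ne (schattenTwo_nonneg _) (Ne.symm hzero)
    rw [← Real.logb_lt_iff_lt_rpow one_lt_two (by positivity), Real.logb_pow]
    exact_mod_cast hlt
  · simp at hlt

lemma two_rpow_sum_logb_sub {κ : Type*} (S : Finset κ) {A : κ → ℕ} (hA : ∀ i, 0 < A i) {ε t : ℝ}
    (hε : 0 < ε) (ht : 0 < t) :
    (2 : ℝ) ^ (∑ s ∈ S, Real.logb 2 (A s) - (Real.logb 2 (ε ^ (-2 : ℤ)) + Real.logb 2 t⁻¹))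
      = (∏ s ∈ S, (A s : ℝ)) * (ε ^ 2 * t) := by
  have hA' : ∀ i, (0 : ℝ) < A i := fun i => Nat.cast_pos.2 (hA i)
  have hprod : 0 < ∏ s ∈ S, (A s : ℝ) := Finset.prod_pos fun i _ => hA' i
  rw [← Real.logb_prod S _ fun i _ => (hA' i).ne', ← Real.logb_mul (by positivity) (by positivity),
    ← Real.logb_div hprod.ne' (by positivity), Real.rpow_logb two_pos (by norm_num) (by positivity),
    zpow_neg, div_eq_mul_inv, mul_inv, inv_inv, inv_inv]
  norm_cast

end Rate

section Components

open Finset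

lemma sum_erase_empty_two_pow_card (k : ℕ) :
    ∑ S ∈ univ.erase (∅ : Finset (Fin k)), (2 : ℝ) ^ #S = 3 ^ k - 1 := by
  have hall := Fintype.sum_pow_mul_eq_add_pow (Fin k) (2 : ℝ) 1
  have herase := add_sum_erase univ (fun S : Finset (Fin k) => (2 : ℝ) ^ #S) (mem_univ ∅)
  simp only [one_pow, mul_one, Fintype.card_fin] at hall
  rw [hall, card_empty, pow_zero, show (2 : ℝ) + 1 = 3 by norm_num] at herase
  linarith

variable {k : ℕ} {X : Fin k → Type*} [∀ i, Fintype (X i)] [∀ i, DecidableEq (X i)]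
  {m : Type*} [Fintype m] [DecidableEq m]
  {p : (∀ i, X i) → ℝ} {q : ∀ i, X i → ℝ} {ρ : (∀ i, X i) → Matrix m m ℂ}
  {A : Fin k → ℕ}

lemma schattenOne_sampleAverage_sub_le (hp : ∀ x, 0 ≤ p x) (hq : ∀ i, ∑ a, q i a = 1)
    (hac : ∀ y, weight q y = 0 → p y = 0) (hρ : ∀ x, (ρ x).PosSemidef) [∀ i, NeZero (A i)]
    (ω : ∀ s : Σ i, Fin (A i), X s.1) :
    schattenOne (sampleAverage p q ρ A (fun i j => ω ⟨i, j⟩) - reduceToM (controlState p ρ))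
      ≤ ∑ S ∈ univ.erase ∅, traceSeminorm m (sampleMean (hoeffding q S (reweighted p q ρ)) ω) := by
  rw [schattenOne_eq_traceSeminorm ((isHermitian_sampleAverage (fun x => (hρ x).isHermitian) _).sub
      (posSemidef_reduceToM_controlState hp hρ).isHermitian),
    sampleAverage_eq_sampleMean, ← expectation_reweighted hac, sampleMean_sub_expectation hq]
  exact le_sum_of_subadditive _ (map_zero _).le (map_add_le_add _) _ _

lemma expectation_traceSeminorm_component_lt (hp : ∀ x, 0 ≤ p x) (hq0 : ∀ i a, 0 ≤ q i a)
    (hq : ∀ i, ∑ a, q i a = 1) (hac : ∀ y, weight q y = 0 → p y = 0)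
    (hρ : ∀ x, (ρ x).PosSemidef) (hpos : 0 < (controlState p ρ).trace.re)
    [∀ i, NeZero (A i)] {ε : ℝ} (hε : 0 < ε) {S : Finset (Fin k)}
    (hrate : smoothRenyiTwo ε (reduceTo S (controlState p ρ))
          (productState q S ⊗ₖ reduceToM (controlState p ρ))
        + ((Real.logb 2 (ε ^ (-2 : ℤ)) + Real.logb 2 ((controlState p ρ).trace.re)⁻¹ : ℝ) : EReal)
        < ((∑ s ∈ S, Real.logb 2 (A s) : ℝ) : EReal)) :
    (expectation (fun s : Σ i, Fin (A i) => q s.1) fun ω =>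
        traceSeminorm m (sampleMean (hoeffding q S (reweighted p q ρ)) ω))
      < 2 ^ #S * (2 * (ε * (controlState p ρ).trace.re)) := by
  set t := (controlState p ρ).trace.re
  have hA (i : Fin k) : 0 < A i := Nat.pos_of_neZero _
  have hprod : 0 < ∏ i ∈ S, (A i : ℝ) := prod_pos fun i _ => Nat.cast_pos.2 (hA i)
  have hγ := isHermitian_reduceTo S (isHermitian_controlState (p := p) fun x => (hρ x).isHermitian)
  have hrate' := (EReal.lt_sub_iff_add_lt (.inl (EReal.coe_ne_bot _))
    (.inl (EReal.coe_ne_top _))).2 hrate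
  rw [← EReal.coe_sub] at hrate'
  obtain ⟨α, hα, hdist, hsupp, hrenyi⟩ := exists_of_smoothRenyiTwo_lt hrate'
  rw [two_rpow_sum_logb_sub S hA hε hpos] at hrenyi
  rw [trace_reduceTo, schattenOne_eq_traceSeminorm (hα.1.isHermitian.sub hγ), map_sub_rev,
    ← schattenOne_eq_traceSeminorm (hγ.sub hα.1.isHermitian)] at hdist
  refine (expectation_traceSeminorm_sampleMean_hoeffding_le
    (β := productState q S ⊗ₖ reduceToM (controlState p ρ)) hq0 hq (average_reweighted hq hac S)
    hγ hα.1.isHermitian (posSemidef_reduceToM_controlState hp hρ) rfl hsupp).trans_lt ?_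
  gcongr
  rw [two_mul]
  refine add_lt_add_of_le_of_lt hdist ?_
  rw [trace_reduceToM, ← Real.sqrt_mul hpos.le, Real.sqrt_lt' (by positivity)]
  simp only [Fintype.card_fin]
  calc _ < t * ((∏ i ∈ S, (A i : ℝ))⁻¹ * ((∏ i ∈ S, (A i : ℝ)) * (ε ^ 2 * t))) := by gcongr
    _ = (ε * t) ^ 2 := by rw [inv_mul_cancel_left₀ hprod.ne']; ring

end Components

end SoftCovering

end

open SoftCovering

theorem mainTheorem9_general
    (k : ℕ) (hk : 0 < k)
    (X : Fin k → Type*) [∀ i, Fintype (X i)] [∀ i, DecidableEq (X i)]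
    (m : Type*) [Fintype m] [DecidableEq m]
    (p : (∀ i, X i) → ℝ) (hp : ∀ x, 0 ≤ p x)
    (q : ∀ i, X i → ℝ) (hq : ∀ i, q i ∈ stdSimplex ℝ (X i))
    (hsupp : ∀ i, Function.support (marginal p i) ⊆ Function.support (q i))
    (ρ : (∀ i, X i) → Matrix m m ℂ) (hρ : ∀ x, (ρ x).PosSemidef)
    (hpos : 0 < (controlState p ρ).trace.re)
    (A : Fin k → ℕ) (hA : ∀ i, 0 < A i)
    (ε : ℝ) (hε : 0 < ε)
    (hrate : ∀ S : Finset (Fin k), S.Nonempty →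
      smoothRenyiTwo ε (reduceTo S (controlState p ρ))
          (productState q S ⊗ₖ reduceToM (controlState p ρ))
        + ((Real.logb 2 (ε ^ (-2 : ℤ)) + Real.logb 2 ((controlState p ρ).trace.re)⁻¹ : ℝ) : EReal)
        < ((∑ s ∈ S, Real.logb 2 (A s) : ℝ) : EReal)) :
    expectIID q A (fun x =>
        schattenOne (sampleAverage p q ρ A x - reduceToM (controlState p ρ)))
      < 2 * (3 ^ k - 1) * ε * (controlState p ρ).trace.re := by
  have hq0 (i a) : 0 ≤ q i a := (hq i).1 a
  have hq1 (i) : ∑ a, q i a = 1 := (hq i).2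
  have hac (y) : weight q y = 0 → p y = 0 := eq_zero_of_weight_eq_zero hp hsupp
  have : ∀ i, NeZero (A i) := fun i => ⟨(hA i).ne'⟩
  have hnonempty : (Finset.univ.erase (∅ : Finset (Fin k))).Nonempty := ⟨{⟨0, hk⟩}, by simp⟩
  let D (S : Finset (Fin k)) (ω : ∀ s : Σ i, Fin (A i), X s.1) : ℝ :=
    traceSeminorm m (sampleMean (hoeffding q S (reweighted p q ρ)) ω)
  calc _ ≤ expectation (fun s : Σ i, Fin (A i) => q s.1) (∑ S ∈ Finset.univ.erase ∅, D S) := by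
        rw [expectIID_eq_expectation]
        refine expectation_mono (fun s => hq0 s.1) fun ω => ?_
        rw [Finset.sum_apply]
        exact schattenOne_sampleAverage_sub_le hp hq1 hac hρ ω
    _ = ∑ S ∈ Finset.univ.erase ∅, expectation (fun s : Σ i, Fin (A i) => q s.1) (D S) :=
        map_sum _ _ _
    _ < ∑ S ∈ Finset.univ.erase (∅ : Finset (Fin k)),
          2 ^ S.card * (2 * (ε * (controlState p ρ).trace.re)) :=
        Finset.sum_lt_sum_of_nonempty hnonempty fun S hS =>
          expectation_traceSeminorm_component_lt hp hq0 hq1 hac hρ hpos hε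
            (hrate S (Finset.nonempty_iff_ne_empty.2 (Finset.ne_of_mem_erase hS)))
    _ = _ := by
        rw [← Finset.sum_mul, sum_erase_empty_two_pow_card]
        ring

theorem mainTheorem9
    (k : ℕ) (hk : 0 < k)
    (X : Fin k → Type*) [∀ i, Fintype (X i)] [∀ i, DecidableEq (X i)]
    (m : Type*) [Fintype m] [DecidableEq m]
    (p : (∀ i, X i) → ℝ) (hp : p ∈ stdSimplex ℝ (∀ i, X i))
    (q : ∀ i, X i → ℝ) (hq : ∀ i, q i ∈ stdSimplex ℝ (X i))
    (hsupp : ∀ i, Function.support (SoftCovering.marginal p i) ⊆ Function.support (q i))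
    (ρ : (∀ i, X i) → Matrix m m ℂ) (hρ : ∀ x, SoftCovering.IsSubnormalised (ρ x))
    (hpos : 0 < (SoftCovering.controlState p ρ).trace.re)
    (A : Fin k → ℕ) (hA : ∀ i, 0 < A i)
    (ε : ℝ) (hε : 0 < ε) (hε' : ε < 1)
    (hrate : ∀ S : Finset (Fin k), S.Nonempty →
      SoftCovering.smoothRenyiTwo ε
          (SoftCovering.reduceTo S (SoftCovering.controlState p ρ))
          (Matrix.kroneckerMap (· * ·) (SoftCovering.productState q S)
            (SoftCovering.reduceToM (SoftCovering.controlState p ρ)))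
        + ((Real.logb 2 (ε ^ (-2 : ℤ))
            + Real.logb 2 ((SoftCovering.controlState p ρ).trace.re)⁻¹ : ℝ) : EReal)
        < ((∑ s ∈ S, Real.logb 2 (A s) : ℝ) : EReal)) :
    SoftCovering.expectIID q A (fun x =>
        SoftCovering.schattenOne
          (SoftCovering.sampleAverage p q ρ A x
            - SoftCovering.reduceToM (SoftCovering.controlState p ρ)))
      < 2 * (3 ^ k - 1) * ε * (SoftCovering.controlState p ρ).trace.re :=
  mainTheorem9_general k hk X m p hp.1 q hq hsupp ρ (fun x => (hρ x).1) hpos A hA ε hε hrate
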